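/- Rings are associative with unit, and $R\text{-Mod}$ is the category of left $R$-modules. For a class $\mathcal C$ of left $R$-modules put $\mathcal C^\perp=\{X\mid \mathrm{Ext}^1_R(C,X)=0\ \forall C\in\mathcal C\}$ and ${}^\perp\mathcal C=\{X\mid \mathrm{Ext}^1_R(X,C)=0\ \forall C\in\mathcal C\}$. A pair $(\mathcal C,\mathcal D)$ of classes is a *cotorsion pair* if $\mathcal C^\perp=\mathcal D$ and ${}^\perp\mathcal D=\mathcal C$. It is *complete* if every module $Z$ has short exact sequences $0\to D_1\to C_1\to Z\to 0$ and $0\to Z\to D_2\to C_2\to 0$ with $C_i\in\mathcal C$, $D_i\in\mathcal D$, and *hereditary* if $\mathcal C$ is closed under kernels of epimorphisms (between modules in $\mathcal C$) and $\mathcal D$ is closed under cokernels of monomorphisms (between modules in $\mathcal D$). Let $A,B$ be rings, ${}_BM_A$ and ${}_AN_B$ bimodules, and $\phi:M\otimes_AN\to B$, $\psi:N\otimes_BM\to A$ bimodule maps with $m'\psi(n\otimes m)=\phi(m'\otimes n)m$ and $n'\phi(m\otimes n)=\psi(n'\otimes m)n$ for all $m,m'\in M$, $n,n'\in N$. Let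 $\Lambda=\begin{pmatrix}A&N\\M&B\end{pmatrix}$ be the corresponding Morita ring, with multiplication $$\begin{pmatrix}a&n\\m&b\end{pmatrix}\begin{pmatrix}a'&n'\\m'&b'\end{pmatrix}=\begin{pmatrix}aa'+\psi(n\otimes m')&an'+nb'\\ma'+bm'&\phi(m\otimes n')+bb'\end{pmatrix}.$$ A left $\Lambda$-module $W$ is identified with the quadruple $\begin{pmatrix}X\\Y\end{pmatrix}_{f,g}$, where $X=e_1W\in A\text{-Mod}$ and $Y=e_2W\in B\text{-Mod}$ for the diagonal idempotents $e_1=\begin{pmatrix}1&0\\0&0\end{pmatrix}$ and $e_2=\begin{pmatrix}0&0\\0&1\end{pmatrix}$, and $f:M\otimes_AX\to Y$ ($B$-linear) and $g:N\otimes_BY\to X$ ($A$-linear) are given by the action of the off-diagonal entries. Let $\tilde f:X\to\mathrm{Hom}_B(M,Y)$ and $\tilde g:Y\to\mathrm{Hom}_A(N,X)$ be the adjoints of $f$ and $g$. Let $(\mathcal U,\mathcal X)$ and $(\mathcal V,\mathcal Y)$ be cotorsion pairs in $A\text{-Mod}$ and $B\text{-Mod}$, respectively, and consider the following classes of left $\Lambda$-modules: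 $$\mathcal M^{\mathcal V}_{\mathcal U}=\{\mathrm{Coker} f\in\mathcal V,\ X\in\mathcal U,\ f\text{ mono}\},\qquad \mathcal N^{\mathcal Y}_{\mathcal X}=\{\mathrm{Ker}\,\tilde g\in\mathcal Y,\ X\in\mathcal X,\ \tilde g\text{ epi}\},$$ $$\mathcal M^{\mathcal U}_{\mathcal V}=\{\mathrm{Coker}\, g\in\mathcal U,\ Y\in\mathcal V,\ g\text{ mono}\},\qquad \mathcal N^{\mathcal X}_{\mathcal Y}=\{\mathrm{Ker}\,\tilde f\in\mathcal X,\ Y\in\mathcal Y,\ \tilde f\text{ epi}\}.$$ **Corollary 4.8.** Assume that $M\otimes_AN=0$. (1) If $\mathrm{Tor}_1^A(M,U)=0$ for all $U\in\mathcal U$, then $({}^\perp\mathcal N^{\mathcal Y}_{\mathcal X},\mathcal N^{\mathcal Y}_{\mathcal X})$ is a cotorsion pair in $\Lambda\text{-Mod}$. If $\mathrm{Ext}^1_A(N,X)=0$ for all $X\in\mathcal X$, then $(\mathcal M^{\mathcal V}_{\mathcal U},(\mathcal M^{\mathcal V}_{\mathcal U})^\perp)$ is a cotorsion pair in $\Lambda\text{-Mod}$.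 (2) If both vanishing conditions of (1) hold, then $(\mathcal M^{\mathcal V}_{\mathcal U},\mathcal N^{\mathcal Y}_{\mathcal X})$ is a cotorsion pair in $\Lambda\text{-Mod}$; and it is complete and hereditary if both $(\mathcal U,\mathcal X)$ and $(\mathcal V,\mathcal Y)$ are complete and hereditary. **Corollary 4.9.** Assume that $N\otimes_BM=0$. (1) If $\mathrm{Tor}_1^B(N,V)=0$ for all $V\in\mathcal V$, then $({}^\perp\mathcal N^{\mathcal X}_{\mathcal Y},\mathcal N^{\mathcal X}_{\mathcal Y})$ is a cotorsion pair in $\Lambda\text{-Mod}$. If $\mathrm{Ext}^1_B(M,Y)=0$ for all $Y\in\mathcal Y$, then $(\mathcal M^{\mathcal U}_{\mathcal V},(\mathcal M^{\mathcal U}_{\mathcal V})^\perp)$ is a cotorsion pair in $\Lambda\text{-Mod}$. (2) If both vanishing conditions of (1) hold, then $(\mathcal M^{\mathcal U}_{\mathcal V},\mathcal N^{\mathcal X}_{\mathcal Y})$ is a cotorsion pair in $\Lambda\text{-Mod}$; and it is complete and hereditary if both $(\mathcal U,\mathcal X)$ and $(\mathcal V,\mathcal Y)$ are complete and hereditary.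 -/

import Mathlib

open CategoryTheory CategoryTheory.Abelian MulOpposite
open scoped TensorProduct

universe u

/-! ### Tensor products over a noncommutative ring

Right `A`-modules are modules over `Aᵐᵒᵖ`, so `m · a` is written `op a • m`. -/

/-- The subgroup of `M ⊗_ℤ X` generated by the elements `(m · a) ⊗ x - m ⊗ (a · x)`. -/
def balancedRelations (A M X : Type u) [Ring A] [AddCommGroup M] [Module Aᵐᵒᵖ M]
    [AddCommGroup X] [Module A X] : AddSubgroup (M ⊗[ℤ] X) :=
  AddSubgroup.closure {t | ∃ (m : M) (a : A) (x : X),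
    t = (op a • m) ⊗ₜ[ℤ] x - m ⊗ₜ[ℤ] (a • x)}

/-- The tensor product `M ⊗_A X` of a right `A`-module `M` and a left `A`-module `X`. -/
def BalTensor (A M X : Type u) [Ring A] [AddCommGroup M] [Module Aᵐᵒᵖ M]
    [AddCommGroup X] [Module A X] : Type u :=
  (M ⊗[ℤ] X) ⧸ balancedRelations A M X

namespace BalTensor

section

variable {A M X M' X' P : Type u} [Ring A]
  [AddCommGroup M] [Module Aᵐᵒᵖ M] [AddCommGroup X] [Module A X]
  [AddCommGroup M'] [Module Aᵐᵒᵖ M'] [AddCommGroup X'] [Module A X']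
  [AddCommGroup P]

instance : AddCommGroup (BalTensor A M X) :=
  inferInstanceAs (AddCommGroup ((M ⊗[ℤ] X) ⧸ balancedRelations A M X))

variable (A M X) in
/-- The quotient map `M ⊗_ℤ X → M ⊗_A X`. -/
def mk : (M ⊗[ℤ] X) →+ BalTensor A M X := QuotientAddGroup.mk' (balancedRelations A M X)

variable (A) in
/-- The pure tensor `m ⊗ x` in `M ⊗_A X`. -/
def tmul (m : M) (x : X) : BalTensor A M X :=
  mk A M X (m ⊗ₜ[ℤ] x)

theorem tmul_add (m : M) (x y : X) : tmul A m (x + y) = tmul A m x + tmul A m y := by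
  simp only [tmul, TensorProduct.tmul_add, map_add]

theorem add_tmul (m n : M) (x : X) : tmul A (m + n) x = tmul A m x + tmul A n x := by
  simp only [tmul, TensorProduct.add_tmul, map_add]

@[simp]
theorem tmul_zero (m : M) : tmul A m (0 : X) = 0 := by
  simpa using tmul_add (A := A) m (0 : X) 0

@[simp]
theorem zero_tmul (x : X) : tmul A (0 : M) x = 0 := by
  simpa using add_tmul (A := A) (0 : M) 0 x

theorem smul_tmul (m : M) (a : A) (x : X) : tmul A (op a • m) x = tmul A m (a • x) := by
  refine (QuotientAddGroup.eq_iff_sub_mem).2 (AddSubgroup.subset_closure ⟨m, a, x, rfl⟩)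

@[elab_as_elim]
theorem induction_on {motive : BalTensor A M X → Prop} (t : BalTensor A M X)
    (zero : motive 0) (tmul : ∀ m x, motive (tmul A m x))
    (add : ∀ s t, motive s → motive t → motive (s + t)) : motive t := by
  obtain ⟨t, rfl⟩ : ∃ s, mk A M X s = t := QuotientAddGroup.mk'_surjective _ t
  induction t with
  | zero => rw [map_zero]; exact zero
  | tmul m x => exact tmul m x
  | add s t hs ht => rw [map_add]; exact add _ _ hs ht

/-- The universal property of `M ⊗_A X`: a biadditive `A`-balanced map factors through it. -/
def lift (f : M →+ X →+ P) (hf : ∀ (m : M) (a : A) (x : X), f (op a • m) x = f m (a • x)) :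
    BalTensor A M X →+ P :=
  QuotientAddGroup.lift (balancedRelations A M X)
    (TensorProduct.liftAddHom f fun r m x => by
      rw [map_zsmul, map_zsmul, AddMonoidHom.coe_smul, Pi.smul_apply]) <| by
    refine (AddSubgroup.closure_le _).2 ?_
    rintro _ ⟨m, a, x, rfl⟩
    simp [hf]

@[simp]
theorem lift_tmul (f : M →+ X →+ P)
    (hf : ∀ (m : M) (a : A) (x : X), f (op a • m) x = f m (a • x)) (m : M) (x : X) :
    lift f hf (tmul A m x) = f m x := rfl

@[ext]
theorem addHom_ext {f g : BalTensor A M X →+ P}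
    (h : ∀ m x, f (tmul A m x) = g (tmul A m x)) : f = g := by
  ext t
  induction t using induction_on with
  | zero => simp
  | tmul m x => exact h m x
  | add s t hs ht => simp [hs, ht]

/-- The additive map `f ⊗ g : M ⊗_A X → M' ⊗_A X'`. -/
def map (f : M →ₗ[Aᵐᵒᵖ] M') (g : X →ₗ[A] X') : BalTensor A M X →+ BalTensor A M' X' :=
  lift
    (AddMonoidHom.mk' (fun m => AddMonoidHom.mk' (fun x => tmul A (f m) (g x))
        fun x y => by rw [map_add, tmul_add])
      fun m n => by ext x; simp [add_tmul])
    fun m a x => by simp [smul_tmul]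

@[simp]
theorem map_tmul (f : M →ₗ[Aᵐᵒᵖ] M') (g : X →ₗ[A] X') (m : M) (x : X) :
    map f g (tmul A m x) = tmul A (f m) (g x) := rfl

/-- If `M` is a `B`-`A`-bimodule then `M ⊗_A X` is a left `B`-module, with
`b • (m ⊗ x) = (b • m) ⊗ x`. -/
instance {B : Type u} [Ring B] [Module B M] [SMulCommClass B Aᵐᵒᵖ M] :
    Module B (BalTensor A M X) :=
  Module.compHom (BalTensor A M X)
    ({ toFun := fun b => map (DistribSMul.toLinearMap Aᵐᵒᵖ M b) (LinearMap.id : X →ₗ[A] X)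
       map_one' := addHom_ext fun m x => congrArg (tmul A · x) (one_smul B m)
       map_mul' := fun b c => addHom_ext fun m x => congrArg (tmul A · x) (mul_smul b c m)
       map_zero' := addHom_ext fun m x =>
         (congrArg (tmul A · x) (zero_smul B m)).trans (zero_tmul x)
       map_add' := fun b c => addHom_ext fun m x =>
         (congrArg (tmul A · x) (add_smul b c m)).trans (add_tmul _ _ x) } :
      B →+* AddMonoid.End (BalTensor A M X))

@[simp]
theorem smul_def {B : Type u} [Ring B] [Module B M] [SMulCommClass B Aᵐᵒᵖ M]
    (b : B) (m : M) (x : X) : b • tmul A m x = tmul A (b • m) x := rfl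

end

/-- The functor `M ⊗_A -` from left `A`-modules to abelian groups. -/
def functor (A M : Type u) [Ring A] [AddCommGroup M] [Module Aᵐᵒᵖ M] :
    ModuleCat.{u} A ⥤ AddCommGrpCat.{u} where
  obj X := AddCommGrpCat.of (BalTensor A M X)
  map g := AddCommGrpCat.ofHom (map LinearMap.id g.hom)
  map_id X := by ext : 1; apply addHom_ext; intros; rfl
  map_comp f g := by ext : 1; apply addHom_ext; intros; rfl

instance (A M : Type u) [Ring A] [AddCommGroup M] [Module Aᵐᵒᵖ M] :
    (functor A M).Additive where
  map_add {X Y f g} := by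
    ext : 1
    apply addHom_ext
    intro m x
    exact tmul_add m (f.hom x) (g.hom x)

end BalTensor

/-- `Tor₁^A(M, X) = 0`, where `Tor₁^A(M, -)` is the first left derived functor of `M ⊗_A -`. -/
def TorOneVanishes (A M : Type u) [Ring A] [AddCommGroup M] [Module Aᵐᵒᵖ M]
    (X : ModuleCat.{u} A) : Prop :=
  Limits.IsZero (((BalTensor.functor A M).leftDerived 1).obj X)

/-! ### The left module `Hom_A(N, X)` -/

/-- The group `Hom_A(N, X)`. When `N` is an `A`-`B`-bimodule it is regarded as a left
`B`-module by `(b • h)(n) = h(n · b)`. -/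
def HomLeft (A N X : Type u) [Ring A] [AddCommGroup N] [Module A N]
    [AddCommGroup X] [Module A X] : Type u :=
  N →ₗ[A] X

namespace HomLeft

variable {A B N X : Type u} [Ring A] [Ring B] [AddCommGroup N] [Module A N]
  [Module Bᵐᵒᵖ N] [SMulCommClass A Bᵐᵒᵖ N] [AddCommGroup X] [Module A X]

instance : AddCommGroup (HomLeft A N X) := inferInstanceAs (AddCommGroup (N →ₗ[A] X))

instance : FunLike (HomLeft A N X) N X := inferInstanceAs (FunLike (N →ₗ[A] X) N X)

@[ext]
theorem ext {h k : HomLeft A N X} (H : ∀ n, h n = k n) : h = k := LinearMap.ext H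

instance : Module B (HomLeft A N X) where
  smul b h :=
    { toFun := fun n => h (op b • n)
      map_add' := fun n n' => by
        rw [smul_add]; exact LinearMap.map_add (h : N →ₗ[A] X) _ _
      map_smul' := fun a n => by
        rw [← smul_comm]; exact LinearMap.map_smul (h : N →ₗ[A] X) _ _ }
  one_smul h := ext fun n => congrArg h (one_smul _ n)
  mul_smul b c h := ext fun n => congrArg h (by rw [op_mul, mul_smul])
  smul_zero b := rfl
  smul_add b h k := rfl
  add_smul b c h := ext fun n => by
    change h (op (b + c) • n) = h (op b • n) + h (op c • n)
    rw [MulOpposite.op_add, add_smul]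
    exact LinearMap.map_add (h : N →ₗ[A] X) _ _
  zero_smul h := ext fun n => by
    change h (op (0 : B) • n) = 0
    rw [op_zero, zero_smul]
    exact LinearMap.map_zero (h : N →ₗ[A] X)

theorem smul_apply (b : B) (h : HomLeft A N X) (n : N) : (b • h) n = h (op b • n) := rfl

end HomLeft

/-- The `B`-linear map `Y → Hom_A(N, X)`, `y ↦ (n ↦ g (n ⊗ y))`, adjoint to the `A`-linear map
`g : N ⊗_B Y → X`. -/
def tensorHomAdjoint {A B N X Y : Type u} [Ring A] [Ring B] [AddCommGroup N] [Module A N]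
    [Module Bᵐᵒᵖ N] [SMulCommClass A Bᵐᵒᵖ N] [AddCommGroup X] [Module A X]
    [AddCommGroup Y] [Module B Y] (g : BalTensor B N Y →ₗ[A] X) : Y →ₗ[B] HomLeft A N X where
  toFun y :=
    ({ toFun := fun n => g (BalTensor.tmul B n y)
       map_add' := fun n n' => by rw [BalTensor.add_tmul, map_add]
       map_smul' := fun a n => by
         rw [← BalTensor.smul_def, map_smul, RingHom.id_apply] } : N →ₗ[A] X)
  map_add' y y' := HomLeft.ext fun n => by
    change g _ = g _ + g _
    rw [BalTensor.tmul_add, map_add]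
  map_smul' b y := HomLeft.ext fun n => by
    change g (BalTensor.tmul B n (b • y)) = g (BalTensor.tmul B (op b • n) y)
    rw [BalTensor.smul_tmul]

/-! ### Morita rings and their modules -/

section Morita

variable {A B M N : Type u} [Ring A] [Ring B]
  [AddCommGroup M] [Module B M] [Module Aᵐᵒᵖ M] [SMulCommClass B Aᵐᵒᵖ M]
  [AddCommGroup N] [Module A N] [Module Bᵐᵒᵖ N] [SMulCommClass A Bᵐᵒᵖ N]

variable (A B M N) in
/-- A Morita context: bimodule maps `φ : M ⊗_A N → B` and `ψ : N ⊗_B M → A` with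
`m' ψ(n ⊗ m) = φ(m' ⊗ n) m` and `n' φ(m ⊗ n) = ψ(n' ⊗ m) n`. -/
structure MoritaContext where
  φ : BalTensor A M N →ₗ[B] B
  φ_right : ∀ (m : M) (n : N) (b : B),
    φ (BalTensor.tmul A m (op b • n)) = φ (BalTensor.tmul A m n) * b
  ψ : BalTensor B N M →ₗ[A] A
  ψ_right : ∀ (n : N) (m : M) (a : A),
    ψ (BalTensor.tmul B n (op a • m)) = ψ (BalTensor.tmul B n m) * a
  smul_ψ : ∀ (m' m : M) (n : N),
    op (ψ (BalTensor.tmul B n m)) • m' = φ (BalTensor.tmul A m' n) • m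
  smul_φ : ∀ (n' n : N) (m : M),
    op (φ (BalTensor.tmul A m n)) • n' = ψ (BalTensor.tmul B n' m) • n

/-- The elements of the Morita ring: matrices with rows `(a, n)` and `(m, b)`. -/
@[ext]
structure MoritaRing (D : MoritaContext A B M N) where
  a : A
  n : N
  m : M
  b : B

namespace MoritaRing

variable {D : MoritaContext A B M N}

instance : Zero (MoritaRing D) := ⟨⟨0, 0, 0, 0⟩⟩
instance : One (MoritaRing D) := ⟨⟨1, 0, 0, 1⟩⟩
instance : Add (MoritaRing D) := ⟨fun x y => ⟨x.a + y.a, x.n + y.n, x.m + y.m, x.b + y.b⟩⟩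
instance : Neg (MoritaRing D) := ⟨fun x => ⟨-x.a, -x.n, -x.m, -x.b⟩⟩

/-- Matrix multiplication, the products `N × M → A` and `M × N → B` being given by `ψ` and `φ`. -/
instance : Mul (MoritaRing D) := ⟨fun x y =>
  ⟨x.a * y.a + D.ψ (BalTensor.tmul B x.n y.m),
   x.a • y.n + op y.b • x.n,
   op y.a • x.m + x.b • y.m,
   D.φ (BalTensor.tmul A x.m y.n) + x.b * y.b⟩⟩

@[simp] theorem zero_a : (0 : MoritaRing D).a = 0 := rfl
@[simp] theorem zero_n : (0 : MoritaRing D).n = 0 := rfl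
@[simp] theorem zero_m : (0 : MoritaRing D).m = 0 := rfl
@[simp] theorem zero_b : (0 : MoritaRing D).b = 0 := rfl
@[simp] theorem one_a : (1 : MoritaRing D).a = 1 := rfl
@[simp] theorem one_n : (1 : MoritaRing D).n = 0 := rfl
@[simp] theorem one_m : (1 : MoritaRing D).m = 0 := rfl
@[simp] theorem one_b : (1 : MoritaRing D).b = 1 := rfl
@[simp] theorem add_a (x y : MoritaRing D) : (x + y).a = x.a + y.a := rfl
@[simp] theorem add_n (x y : MoritaRing D) : (x + y).n = x.n + y.n := rfl
@[simp] theorem add_m (x y : MoritaRing D) : (x + y).m = x.m + y.m := rfl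
@[simp] theorem add_b (x y : MoritaRing D) : (x + y).b = x.b + y.b := rfl
@[simp] theorem neg_a (x : MoritaRing D) : (-x).a = -x.a := rfl
@[simp] theorem neg_n (x : MoritaRing D) : (-x).n = -x.n := rfl
@[simp] theorem neg_m (x : MoritaRing D) : (-x).m = -x.m := rfl
@[simp] theorem neg_b (x : MoritaRing D) : (-x).b = -x.b := rfl
@[simp] theorem mul_a (x y : MoritaRing D) :
    (x * y).a = x.a * y.a + D.ψ (BalTensor.tmul B x.n y.m) := rfl
@[simp] theorem mul_n (x y : MoritaRing D) : (x * y).n = x.a • y.n + op y.b • x.n := rfl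
@[simp] theorem mul_m (x y : MoritaRing D) : (x * y).m = op y.a • x.m + x.b • y.m := rfl
@[simp] theorem mul_b (x y : MoritaRing D) :
    (x * y).b = D.φ (BalTensor.tmul A x.m y.n) + x.b * y.b := rfl

theorem φ_smul (m : M) (n : N) (b : B) :
    D.φ (BalTensor.tmul A (b • m) n) = b * D.φ (BalTensor.tmul A m n) := by
  rw [← BalTensor.smul_def, map_smul, smul_eq_mul]

theorem ψ_smul (m : M) (n : N) (a : A) :
    D.ψ (BalTensor.tmul B (a • n) m) = a * D.ψ (BalTensor.tmul B n m) := by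
  rw [← BalTensor.smul_def, map_smul, smul_eq_mul]

instance : AddCommGroup (MoritaRing D) where
  add_assoc x y z := by ext <;> simp [add_assoc]
  zero_add x := by ext <;> simp
  add_zero x := by ext <;> simp
  add_comm x y := by ext <;> simp [add_comm]
  neg_add_cancel x := by ext <;> simp
  nsmul := nsmulRec
  zsmul := zsmulRec

/-- The Morita ring `Λ_{(φ,ψ)}`. -/
instance : Ring (MoritaRing D) where
  __ := (inferInstance : AddCommGroup (MoritaRing D))
  mul_assoc x y z := by
    ext
    · simp only [mul_a, mul_n, mul_m, add_mul, mul_add, BalTensor.add_tmul, BalTensor.tmul_add,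
        map_add, mul_assoc, D.ψ_right, ψ_smul, BalTensor.smul_tmul]
      abel
    · simp only [mul_a, mul_n, mul_b, smul_add, add_smul, MulOpposite.op_add, op_mul, mul_smul, D.smul_φ,
        ← smul_comm x.a (op z.b) y.n]
      abel
    · simp only [mul_a, mul_m, mul_b, smul_add, add_smul, MulOpposite.op_add, op_mul, mul_smul, D.smul_ψ,
        ← smul_comm x.b (op z.a) y.m]
      abel
    · simp only [mul_b, mul_n, mul_m, add_mul, mul_add, BalTensor.add_tmul, BalTensor.tmul_add,
        map_add, mul_assoc, D.φ_right, φ_smul, BalTensor.smul_tmul]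
      abel
  one_mul x := by ext <;> simp
  mul_one x := by ext <;> simp
  left_distrib x y z := by
    ext <;> simp [mul_add, BalTensor.tmul_add, add_smul] <;> abel
  right_distrib x y z := by
    ext <;> simp [add_mul, BalTensor.add_tmul, add_smul] <;> abel
  zero_mul x := by ext <;> simp
  mul_zero x := by ext <;> simp

end MoritaRing

namespace MoritaContext

variable (D : MoritaContext A B M N)

/-- The idempotent of the Morita ring with entry `1` in the `A`-corner. -/
def e₁ : MoritaRing D := ⟨1, 0, 0, 0⟩

/-- The idempotent of the Morita ring with entry `1` in the `B`-corner. -/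
def e₂ : MoritaRing D := ⟨0, 0, 0, 1⟩

variable (W : Type u) [AddCommGroup W] [Module (MoritaRing D) W]

/-- The subgroup `e₁ W` of a left module `W` over the Morita ring, that is, the set of all `w` with
`e₁ w = w`. -/
def topSubgroup : AddSubgroup W where
  carrier := {w | D.e₁ • w = w}
  zero_mem' := smul_zero _
  add_mem' := fun {x y} hx hy => by
    rw [Set.mem_ofPred_eq] at *; rw [smul_add, hx, hy]
  neg_mem' := fun {x} hx => by
    rw [Set.mem_ofPred_eq] at *; rw [smul_neg, hx]

/-- The first component `X = e₁ W` of a left module `W` over the Morita ring. -/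
def Top : Type u := D.topSubgroup W

instance : AddCommGroup (D.Top W) := inferInstanceAs (AddCommGroup (D.topSubgroup W))

/-- The subgroup `e₂ W` of a left module `W` over the Morita ring, that is, the set of all `w` with
`e₂ w = w`. -/
def botSubgroup : AddSubgroup W where
  carrier := {w | D.e₂ • w = w}
  zero_mem' := smul_zero _
  add_mem' := fun {x y} hx hy => by
    rw [Set.mem_ofPred_eq] at *; rw [smul_add, hx, hy]
  neg_mem' := fun {x} hx => by
    rw [Set.mem_ofPred_eq] at *; rw [smul_neg, hx]

/-- The second component `Y = e₂ W` of a left module `W` over the Morita ring. -/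
def Bot : Type u := D.botSubgroup W

instance : AddCommGroup (D.Bot W) := inferInstanceAs (AddCommGroup (D.botSubgroup W))

variable {W}

/-- The inclusion `X = e₁ W → W`. -/
def topVal : D.Top W →+ W := (D.topSubgroup W).subtype

/-- The inclusion `Y = e₂ W → W`. -/
def botVal : D.Bot W →+ W := (D.botSubgroup W).subtype

theorem topVal_injective : Function.Injective (D.topVal (W := W)) := Subtype.val_injective

theorem botVal_injective : Function.Injective (D.botVal (W := W)) := Subtype.val_injective

theorem e₁_smul_topVal (x : D.Top W) : D.e₁ • D.topVal x = D.topVal x := x.2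

theorem e₂_smul_botVal (y : D.Bot W) : D.e₂ • D.botVal y = D.botVal y := y.2

/-- An element `w` with `e₁ w = w`, as an element of `e₁ W`. -/
def topMk (w : W) (hw : D.e₁ • w = w) : D.Top W := ⟨w, hw⟩

/-- An element `w` with `e₂ w = w`, as an element of `e₂ W`. -/
def botMk (w : W) (hw : D.e₂ • w = w) : D.Bot W := ⟨w, hw⟩

@[simp] theorem topVal_topMk (w : W) (hw : D.e₁ • w = w) : D.topVal (D.topMk w hw) = w := rfl

@[simp] theorem botVal_botMk (w : W) (hw : D.e₂ • w = w) : D.botVal (D.botMk w hw) = w := rfl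

theorem e₁_mul_a (a : A) : D.e₁ * ⟨a, 0, 0, 0⟩ = ⟨a, 0, 0, 0⟩ := by ext <;> simp [e₁]
theorem e₁_mul_n (n : N) : D.e₁ * ⟨0, n, 0, 0⟩ = ⟨0, n, 0, 0⟩ := by ext <;> simp [e₁]
theorem e₂_mul_m (m : M) : D.e₂ * ⟨0, 0, m, 0⟩ = ⟨0, 0, m, 0⟩ := by ext <;> simp [e₂]
theorem e₂_mul_b (b : B) : D.e₂ * ⟨0, 0, 0, b⟩ = ⟨0, 0, 0, b⟩ := by ext <;> simp [e₂]

/-- The left `A`-module structure on `e₁ W`. -/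
instance : Module A (D.Top W) where
  smul a x := D.topMk ((⟨a, 0, 0, 0⟩ : MoritaRing D) • D.topVal x) (by
    rw [smul_smul, e₁_mul_a])
  one_smul x := D.topVal_injective (D.e₁_smul_topVal x)
  mul_smul a a' x := D.topVal_injective (by
    change (⟨a * a', 0, 0, 0⟩ : MoritaRing D) • D.topVal x
      = (⟨a, 0, 0, 0⟩ : MoritaRing D) • (⟨a', 0, 0, 0⟩ : MoritaRing D) • D.topVal x
    rw [smul_smul]; congr 1; ext <;> simp)
  smul_zero a := D.topVal_injective (by
    change (⟨a, 0, 0, 0⟩ : MoritaRing D) • D.topVal (0 : D.Top W) = D.topVal (0 : D.Top W)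
    rw [map_zero, smul_zero])
  smul_add a x y := D.topVal_injective (by
    change (⟨a, 0, 0, 0⟩ : MoritaRing D) • D.topVal (x + y)
      = (⟨a, 0, 0, 0⟩ : MoritaRing D) • D.topVal x + (⟨a, 0, 0, 0⟩ : MoritaRing D) • D.topVal y
    rw [map_add, smul_add])
  add_smul a a' x := D.topVal_injective (by
    change (⟨a + a', 0, 0, 0⟩ : MoritaRing D) • D.topVal x
      = (⟨a, 0, 0, 0⟩ : MoritaRing D) • D.topVal x + (⟨a', 0, 0, 0⟩ : MoritaRing D) • D.topVal x
    rw [← add_smul]; congr 1; ext <;> simp)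
  zero_smul x := D.topVal_injective (zero_smul (MoritaRing D) (D.topVal x))

/-- The left `B`-module structure on `e₂ W`. -/
instance : Module B (D.Bot W) where
  smul b y := D.botMk ((⟨0, 0, 0, b⟩ : MoritaRing D) • D.botVal y) (by
    rw [smul_smul, e₂_mul_b])
  one_smul y := D.botVal_injective (D.e₂_smul_botVal y)
  mul_smul b b' y := D.botVal_injective (by
    change (⟨0, 0, 0, b * b'⟩ : MoritaRing D) • D.botVal y
      = (⟨0, 0, 0, b⟩ : MoritaRing D) • (⟨0, 0, 0, b'⟩ : MoritaRing D) • D.botVal y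
    rw [smul_smul]; congr 1; ext <;> simp)
  smul_zero b := D.botVal_injective (by
    change (⟨0, 0, 0, b⟩ : MoritaRing D) • D.botVal (0 : D.Bot W) = D.botVal (0 : D.Bot W)
    rw [map_zero, smul_zero])
  smul_add b x y := D.botVal_injective (by
    change (⟨0, 0, 0, b⟩ : MoritaRing D) • D.botVal (x + y)
      = (⟨0, 0, 0, b⟩ : MoritaRing D) • D.botVal x + (⟨0, 0, 0, b⟩ : MoritaRing D) • D.botVal y
    rw [map_add, smul_add])
  add_smul b b' y := D.botVal_injective (by
    change (⟨0, 0, 0, b + b'⟩ : MoritaRing D) • D.botVal y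
      = (⟨0, 0, 0, b⟩ : MoritaRing D) • D.botVal y + (⟨0, 0, 0, b'⟩ : MoritaRing D) • D.botVal y
    rw [← add_smul]; congr 1; ext <;> simp)
  zero_smul y := D.botVal_injective (zero_smul (MoritaRing D) (D.botVal y))

variable (W)

/-- The structure map `f : M ⊗_A X → Y` of a module `W` over the Morita ring: `f (m ⊗ x) = m x`,
the product of `x` with the matrix whose only nonzero entry is `m`. -/
def f : BalTensor A M (D.Top W) →ₗ[B] D.Bot W where
  __ := BalTensor.lift (P := D.Bot W)
    (AddMonoidHom.mk' (fun m => AddMonoidHom.mk'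
        (fun (x : D.Top W) => D.botMk ((⟨0, 0, m, 0⟩ : MoritaRing D) • D.topVal x)
          (by rw [smul_smul, e₂_mul_m]))
        fun x y => D.botVal_injective (by simp))
      fun m m' => AddMonoidHom.ext fun x => D.botVal_injective (by
        simp only [AddMonoidHom.mk'_apply, AddMonoidHom.add_apply, map_add, botVal_botMk,
          ← add_smul]
        congr 1; ext <;> simp))
    fun m a x => D.botVal_injective (by
      change (⟨0, 0, op a • m, 0⟩ : MoritaRing D) • D.topVal x
        = (⟨0, 0, m, 0⟩ : MoritaRing D) • (⟨a, 0, 0, 0⟩ : MoritaRing D) • D.topVal x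
      rw [smul_smul]; congr 1; ext <;> simp)
  map_smul' b t := by
    induction t using BalTensor.induction_on with
    | zero => simp
    | add s t hs ht => simp_all
    | tmul m x =>
      apply D.botVal_injective
      change (⟨0, 0, b • m, 0⟩ : MoritaRing D) • D.topVal x
        = (⟨0, 0, 0, b⟩ : MoritaRing D) • (⟨0, 0, m, 0⟩ : MoritaRing D) • D.topVal x
      rw [smul_smul]; congr 1; ext <;> simp

/-- The structure map `g : N ⊗_B Y → X` of a module `W` over the Morita ring: `g (n ⊗ y) = n y`,
the product of `y` with the matrix whose only nonzero entry is `n`. -/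
def g : BalTensor B N (D.Bot W) →ₗ[A] D.Top W where
  __ := BalTensor.lift (P := D.Top W)
    (AddMonoidHom.mk' (fun n => AddMonoidHom.mk'
        (fun (y : D.Bot W) => D.topMk ((⟨0, n, 0, 0⟩ : MoritaRing D) • D.botVal y)
          (by rw [smul_smul, e₁_mul_n]))
        fun x y => D.topVal_injective (by simp))
      fun n n' => AddMonoidHom.ext fun y => D.topVal_injective (by
        simp only [AddMonoidHom.mk'_apply, AddMonoidHom.add_apply, map_add, topVal_topMk,
          ← add_smul]
        congr 1; ext <;> simp))
    fun n b y => D.topVal_injective (by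
      change (⟨0, op b • n, 0, 0⟩ : MoritaRing D) • D.botVal y
        = (⟨0, n, 0, 0⟩ : MoritaRing D) • (⟨0, 0, 0, b⟩ : MoritaRing D) • D.botVal y
      rw [smul_smul]; congr 1; ext <;> simp)
  map_smul' a t := by
    induction t using BalTensor.induction_on with
    | zero => simp
    | add s t hs ht => simp_all
    | tmul n y =>
      apply D.topVal_injective
      change (⟨0, a • n, 0, 0⟩ : MoritaRing D) • D.botVal y
        = (⟨a, 0, 0, 0⟩ : MoritaRing D) • (⟨0, n, 0, 0⟩ : MoritaRing D) • D.botVal y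
      rw [smul_smul]; congr 1; ext <;> simp

@[simp] theorem botVal_f_tmul (m : M) (x : D.Top W) :
    D.botVal (D.f W (BalTensor.tmul A m x)) = (⟨0, 0, m, 0⟩ : MoritaRing D) • D.topVal x := rfl

@[simp] theorem topVal_g_tmul (n : N) (y : D.Bot W) :
    D.topVal (D.g W (BalTensor.tmul B n y)) = (⟨0, n, 0, 0⟩ : MoritaRing D) • D.botVal y := rfl

/-- The map `f̃ : X → Hom_B(M, Y)` adjoint to `f`. -/
def fTilde : D.Top W →ₗ[A] HomLeft B M (D.Bot W) := tensorHomAdjoint (D.f W)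

/-- The map `g̃ : Y → Hom_A(N, X)` adjoint to `g`. -/
def gTilde : D.Bot W →ₗ[B] HomLeft A N (D.Top W) := tensorHomAdjoint (D.g W)

/-- The class `M^𝒱_𝒰` of modules over the Morita ring with `Coker f ∈ 𝒱`, `X ∈ 𝒰` and `f` a
monomorphism. -/
def classM₁ (𝒰 : ObjectProperty (ModuleCat.{u} A)) (𝒱 : ObjectProperty (ModuleCat.{u} B)) :
    ObjectProperty (ModuleCat.{u} (MoritaRing D)) := fun W =>
  𝒱 (ModuleCat.of B (D.Bot W ⧸ LinearMap.range (D.f W))) ∧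
    𝒰 (ModuleCat.of A (D.Top W)) ∧ Function.Injective (D.f W)

/-- The class `N^𝒴_𝒳` of modules over the Morita ring with `Ker g̃ ∈ 𝒴`, `X ∈ 𝒳` and `g̃` an
epimorphism. -/
def classN₁ (𝒳 : ObjectProperty (ModuleCat.{u} A)) (𝒴 : ObjectProperty (ModuleCat.{u} B)) :
    ObjectProperty (ModuleCat.{u} (MoritaRing D)) := fun W =>
  𝒴 (ModuleCat.of B (LinearMap.ker (D.gTilde W))) ∧
    𝒳 (ModuleCat.of A (D.Top W)) ∧ Function.Surjective (D.gTilde W)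

/-- The class `M^𝒰_𝒱` of modules over the Morita ring with `Coker g ∈ 𝒰`, `Y ∈ 𝒱` and `g` a
monomorphism. -/
def classM₂ (𝒰 : ObjectProperty (ModuleCat.{u} A)) (𝒱 : ObjectProperty (ModuleCat.{u} B)) :
    ObjectProperty (ModuleCat.{u} (MoritaRing D)) := fun W =>
  𝒰 (ModuleCat.of A (D.Top W ⧸ LinearMap.range (D.g W))) ∧
    𝒱 (ModuleCat.of B (D.Bot W)) ∧ Function.Injective (D.g W)

/-- The class `N^𝒳_𝒴` of modules over the Morita ring with `Ker f̃ ∈ 𝒳`, `Y ∈ 𝒴` and `f̃` an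
epimorphism. -/
def classN₂ (𝒳 : ObjectProperty (ModuleCat.{u} A)) (𝒴 : ObjectProperty (ModuleCat.{u} B)) :
    ObjectProperty (ModuleCat.{u} (MoritaRing D)) := fun W =>
  𝒳 (ModuleCat.of A (LinearMap.ker (D.fTilde W))) ∧
    𝒴 (ModuleCat.of B (D.Bot W)) ∧ Function.Surjective (D.fTilde W)

end MoritaContext

end Morita

/-! ### Cotorsion pairs of left modules -/

section Cotorsion

variable {R : Type u} [Ring R]

/-- `𝒞^⊥`: the modules `X` with `Ext¹(C, X) = 0` for all `C` in `𝒞`. -/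
def extRightPerp (𝒞 : ObjectProperty (ModuleCat.{u} R)) : ObjectProperty (ModuleCat.{u} R) :=
  fun X => ∀ C, 𝒞 C → Subsingleton (Ext C X 1)

/-- `^⊥𝒟`: the modules `X` with `Ext¹(X, D) = 0` for all `D` in `𝒟`. -/
def extLeftPerp (𝒟 : ObjectProperty (ModuleCat.{u} R)) : ObjectProperty (ModuleCat.{u} R) :=
  fun X => ∀ D, 𝒟 D → Subsingleton (Ext X D 1)

/-- `(𝒞, 𝒟)` is a cotorsion pair: `𝒞^⊥ = 𝒟` and `^⊥𝒟 = 𝒞`. -/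
def IsCotorsionPair (𝒞 𝒟 : ObjectProperty (ModuleCat.{u} R)) : Prop :=
  extRightPerp 𝒞 = 𝒟 ∧ extLeftPerp 𝒟 = 𝒞

/-- Every module `Z` has exact sequences `0 → D₁ → C₁ → Z → 0` and `0 → Z → D₂ → C₂ → 0` with
`C₁, C₂ ∈ 𝒞` and `D₁, D₂ ∈ 𝒟`. -/
def IsCompletePair (𝒞 𝒟 : ObjectProperty (ModuleCat.{u} R)) : Prop :=
  ∀ Z : ModuleCat.{u} R,
    (∃ (D₁ C₁ : ModuleCat.{u} R) (i : D₁ ⟶ C₁) (p : C₁ ⟶ Z) (w : i ≫ p = 0),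
      (ShortComplex.mk i p w).ShortExact ∧ 𝒞 C₁ ∧ 𝒟 D₁) ∧
    (∃ (D₂ C₂ : ModuleCat.{u} R) (i : Z ⟶ D₂) (p : D₂ ⟶ C₂) (w : i ≫ p = 0),
      (ShortComplex.mk i p w).ShortExact ∧ 𝒞 C₂ ∧ 𝒟 D₂)

/-- `𝒞` is closed under kernels of epimorphisms and `𝒟` is closed under cokernels of
monomorphisms. -/
def IsHereditaryPair (𝒞 𝒟 : ObjectProperty (ModuleCat.{u} R)) : Prop :=
  (∀ S : ShortComplex (ModuleCat.{u} R), S.ShortExact → 𝒞 S.X₂ → 𝒞 S.X₃ → 𝒞 S.X₁) ∧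
  (∀ S : ShortComplex (ModuleCat.{u} R), S.ShortExact → 𝒟 S.X₁ → 𝒟 S.X₂ → 𝒟 S.X₃)

end Cotorsion

/-! Suppose `M ⊗_A N = 0`. Then `φ = 0`, and `f(m ⊗ g(n ⊗ y)) = φ(m ⊗ n) y` holds automatically
because `M ⊗_A N ⊗_B Y = 0`. The only condition left on a quadruple is that `f : M ⊗ X → Y` followed
by the adjoint `k = g̃ : Y → Hom_A(N, X)` equals the natural map `κ : M ⊗ X → Hom_A(N, X)`, `m ⊗ x ↦
(n ↦ ψ(n ⊗ m) x)`. So a module over the Morita ring is a module `X` with a factorization of `κ`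
through some `Y` (`Quad`, `equivQuadOf`).

Three kinds of test modules follow: `T(X) = (X, M ⊗ X)`, where `T` is left adjoint to `W ↦ X`; `H(X)
= (X, Hom_A(N, X))`, where `H` is right adjoint to it; and `(0, V)`, the maps out of which see `Ker
g̃` and the maps into which see `Coker f`. Vanishing of `Ext¹` from `T(X)` or into `H(X)` is then a
condition on first components (the converse direction needs the Tor or Ext hypothesis, so that `T`
or `H` preserves a short exact sequence). If `g̃` is epi, `Ext¹((0, V), W) = 0` amounts to `Ext¹(V,
Ker g̃) = 0`, and `Ext¹((0, B), W) = 0` forces `g̃` to be epi. Dually, `Ext¹(W, (0, V))` controls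
`Coker f`, and taking `V` injective and containing `M ⊗ X` forces `f` to be mono.

Thus under the Tor hypothesis the class `N` is the right perpendicular of all `T(U)`, `(0, V)`
(`classN₁_of_extZero`), and under the Ext hypothesis the class `M` is the left perpendicular of all
`H(X)`, `(0, Y)` (`classM₁_of_extZero`). Each is therefore one half of a cotorsion pair. Under both
hypotheses the two pairs agree: the test modules lie in `M` and `N` themselves, and `0 → T(X) → W →
(0, Coker f) → 0` gives `Ext¹(M, N) = 0`.

Completeness reduces by Salce's lemma to special precovers, built by three epimorphisms with kernels
`H(X₁)`, `(0, I)` and `(0, Y₃)` in `N`. Heredity is the snake lemma. The case `N ⊗_B M = 0` follows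
by exchanging the two corners of the ring. -/

section ExtToolkit

/-! ### Short exact sequences and vanishing of `Ext¹` for unbundled modules. -/

variable {R : Type u} [Ring R] {C E X E' C' X' : Type u}
  [AddCommGroup C] [Module R C] [AddCommGroup E] [Module R E] [AddCommGroup X] [Module R X]
  [AddCommGroup C'] [Module R C'] [AddCommGroup E'] [Module R E'] [AddCommGroup X'] [Module R X']

/-- `0 → X → E → C → 0` is a short exact sequence of modules. -/
structure IsSES (i : X →ₗ[R] E) (p : E →ₗ[R] C) : Prop where
  inj : Function.Injective i
  exact : Function.Exact i p
  surj : Function.Surjective p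

theorem ModuleCat.shortExact_iff_isSES (S : ShortComplex (ModuleCat.{u} R)) :
    S.ShortExact ↔ IsSES S.f.hom S.g.hom :=
  ⟨fun h => ⟨h.moduleCat_injective_f,
    (ShortComplex.ShortExact.moduleCat_exact_iff_function_exact S).1 h.exact,
    h.moduleCat_surjective_g⟩,
   fun h => ModuleCat.shortComplex_shortExact S h.exact h.inj h.surj⟩

namespace IsSES

variable {i : X →ₗ[R] E} {p : E →ₗ[R] C}

theorem comp_eq_zero (h : IsSES i p) : ModuleCat.ofHom i ≫ ModuleCat.ofHom p = 0 := by
  ext x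
  exact h.exact.apply_apply_eq_zero x

theorem shortExact (h : IsSES i p) : (ShortComplex.mk _ _ h.comp_eq_zero).ShortExact :=
  (ModuleCat.shortExact_iff_isSES _).2 ⟨h.inj, h.exact, h.surj⟩

end IsSES

theorem LinearMap.isSES_ker {p : E →ₗ[R] C} (hp : Function.Surjective p) :
    IsSES (LinearMap.ker p).subtype p :=
  ⟨Subtype.val_injective, LinearMap.exact_subtype_ker_map p, hp⟩

theorem LinearMap.isSES_range {i : X →ₗ[R] E} (hi : Function.Injective i) :
    IsSES i (LinearMap.range i).mkQ :=
  ⟨hi, LinearMap.exact_map_mkQ_range i, Submodule.mkQ_surjective _⟩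

variable (R) in
/-- `Ext¹(C, X) = 0` for unbundled modules. -/
abbrev ExtZero (C X : Type u) [AddCommGroup C] [Module R C] [AddCommGroup X] [Module R X] : Prop :=
  Subsingleton (Ext (ModuleCat.of R C) (ModuleCat.of R X) 1)

namespace ExtZero

theorem of_projective [Module.Projective R C] : ExtZero R C X :=
  have := (IsProjective.iff_projective (R := R) C).1 ‹_›
  Ext.subsingleton_of_projective _ _ 0

theorem of_injective [Module.Injective R X] : ExtZero R C X :=
  have := Module.injective_object_of_injective_module R X
  Ext.subsingleton_of_injective _ _ 0

theorem congr_left (e : C ≃ₗ[R] C') (h : ExtZero R C X) : ExtZero R C' X := by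
  refine subsingleton_of_forall_eq 0 fun x => ?_
  have h1 : (Ext.mk₀ e.toModuleIso.inv).comp
      ((Ext.mk₀ e.toModuleIso.hom).comp x (zero_add 1)) (zero_add 1) = x := by
    rw [Ext.mk₀_comp_mk₀_assoc, Iso.inv_hom_id, Ext.mk₀_id_comp]
  rw [← h1, Subsingleton.elim ((Ext.mk₀ e.toModuleIso.hom).comp x (zero_add 1)) 0, Ext.comp_zero]

theorem congr_right (e : X ≃ₗ[R] X') (h : ExtZero R C X) : ExtZero R C X' := by
  refine subsingleton_of_forall_eq 0 fun x => ?_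
  have h1 : (x.comp (Ext.mk₀ e.toModuleIso.inv) (add_zero 1)).comp
      (Ext.mk₀ e.toModuleIso.hom) (add_zero 1) = x := by
    rw [Ext.comp_assoc_of_second_deg_zero, Ext.mk₀_comp_mk₀, Iso.inv_hom_id, Ext.comp_mk₀_id]
  rw [← h1, Subsingleton.elim (x.comp (Ext.mk₀ e.toModuleIso.inv) (add_zero 1)) 0, Ext.zero_comp]

variable {i : X →ₗ[R] E} {p : E →ₗ[R] C}

/-- The connecting map sends `k` into `Ext¹(C', X) = 0`, and this is the only obstruction to lifting
`k`. -/
theorem lift (hs : IsSES i p) (h : ExtZero R C' X) (k : C' →ₗ[R] C) :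
    ∃ l : C' →ₗ[R] E, p ∘ₗ l = k := by
  obtain ⟨x, hx⟩ := Ext.covariant_sequence_exact₃ _ hs.shortExact (Ext.mk₀ (ModuleCat.ofHom k))
    (zero_add 1) (Subsingleton.elim (α := Ext (ModuleCat.of R C') (ModuleCat.of R X) 1) _ _)
  obtain ⟨l, rfl⟩ := Ext.addEquiv₀.symm.surjective x
  refine ⟨l.hom, ?_⟩
  simp only [Ext.addEquiv₀_symm_apply, Ext.mk₀_comp_mk₀] at hx
  exact congrArg ModuleCat.Hom.hom (Ext.addEquiv₀.symm.injective hx)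

theorem extend (hs : IsSES i p) (h : ExtZero R C X') (k : X →ₗ[R] X') :
    ∃ l : E →ₗ[R] X', l ∘ₗ i = k := by
  obtain ⟨x, hx⟩ := Ext.contravariant_sequence_exact₁ hs.shortExact _
    (Ext.mk₀ (ModuleCat.ofHom k)) (add_zero 1)
    (Subsingleton.elim (α := Ext (ModuleCat.of R C) (ModuleCat.of R X') 1) _ _)
  obtain ⟨l, rfl⟩ := Ext.addEquiv₀.symm.surjective x
  refine ⟨l.hom, ?_⟩
  simp only [Ext.addEquiv₀_symm_apply, Ext.mk₀_comp_mk₀] at hx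
  exact congrArg ModuleCat.Hom.hom (Ext.addEquiv₀.symm.injective hx)

/-- Since `Ext¹(E, X') = 0`, the connecting map `Hom(X, X') → Ext¹(C, X')` is onto, and it kills the
maps that extend to `E`. With `E` projective this turns vanishing of `Ext¹` into an extension
problem for homomorphisms. -/
theorem of_extend (hs : IsSES i p) (hE : ExtZero R E X')
    (h : ∀ k : X →ₗ[R] X', ∃ l : E →ₗ[R] X', l ∘ₗ i = k) : ExtZero R C X' := by
  refine subsingleton_of_forall_eq 0 fun x => ?_
  obtain ⟨y, rfl⟩ := Ext.contravariant_sequence_exact₃ hs.shortExact _ x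
    (Subsingleton.elim (α := Ext (ModuleCat.of R E) (ModuleCat.of R X') 1) _ _) (add_zero 1)
  obtain ⟨k, rfl⟩ := Ext.addEquiv₀.symm.surjective y
  obtain ⟨l, hl⟩ := h k.hom
  obtain rfl : k = ModuleCat.ofHom i ≫ ModuleCat.ofHom l := by ext1; exact hl.symm
  simp only [Ext.addEquiv₀_symm_apply, ← Ext.mk₀_comp_mk₀]
  exact hs.shortExact.extClass_comp_assoc _

theorem of_lift (hs : IsSES i p) (hE : ExtZero R C' E)
    (h : ∀ k : C' →ₗ[R] C, ∃ l : C' →ₗ[R] E, p ∘ₗ l = k) : ExtZero R C' X := by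
  refine subsingleton_of_forall_eq 0 fun x => ?_
  obtain ⟨y, rfl⟩ := Ext.covariant_sequence_exact₁ _ hs.shortExact x
    (Subsingleton.elim (α := Ext (ModuleCat.of R C') (ModuleCat.of R E) 1) _ _) (zero_add 1)
  obtain ⟨k, rfl⟩ := Ext.addEquiv₀.symm.surjective y
  obtain ⟨l, hl⟩ := h k.hom
  obtain rfl : k = ModuleCat.ofHom l ≫ ModuleCat.ofHom p := by ext1; exact hl.symm
  simp only [Ext.addEquiv₀_symm_apply, ← Ext.mk₀_comp_mk₀]
  rw [Ext.comp_assoc _ _ _ (zero_add 0) (zero_add 1) (by norm_num)]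
  have := hs.shortExact.comp_extClass
  dsimp at this
  rw [this, Ext.comp_zero]

theorem middle_left (hs : IsSES i p) (hX : ExtZero R X X') (hC : ExtZero R C X') :
    ExtZero R E X' := by
  refine subsingleton_of_forall_eq 0 fun x => ?_
  obtain ⟨y, rfl⟩ := Ext.contravariant_sequence_exact₂ hs.shortExact _ x
    (Subsingleton.elim (α := Ext (ModuleCat.of R X) (ModuleCat.of R X') 1) _ _)
  rw [Subsingleton.elim (α := Ext (ModuleCat.of R C) (ModuleCat.of R X') 1) y 0, Ext.comp_zero]

theorem middle_right (hs : IsSES i p) (hX : ExtZero R C' X) (hC : ExtZero R C' C) :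
    ExtZero R C' E := by
  refine subsingleton_of_forall_eq 0 fun x => ?_
  obtain ⟨y, rfl⟩ := Ext.covariant_sequence_exact₂ _ hs.shortExact x
    (Subsingleton.elim (α := Ext (ModuleCat.of R C') (ModuleCat.of R C) 1) _ _)
  rw [Subsingleton.elim (α := Ext (ModuleCat.of R C') (ModuleCat.of R X) 1) y 0, Ext.zero_comp]

end ExtZero

variable (R C) in
theorem exists_projective_presentation :
    ∃ (K P : Type u) (_ : AddCommGroup K) (_ : Module R K) (_ : AddCommGroup P) (_ : Module R P)
      (i : K →ₗ[R] P) (p : P →ₗ[R] C), IsSES i p ∧ Module.Projective R P :=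
  ⟨_, C →₀ R, _, _, _, _, _, _,
    LinearMap.isSES_ker (Finsupp.linearCombination_id_surjective R C), inferInstance⟩

variable (R X) in
theorem exists_injective_embedding :
    ∃ (I : Type u) (_ : AddCommGroup I) (_ : Module R I)
      (i : X →ₗ[R] I), Function.Injective i ∧ Module.Injective R I :=
  let J : ModuleCat.{u} R := Injective.under (ModuleCat.of R X)
  have : Injective (ModuleCat.of R J) := inferInstanceAs (Injective J)
  ⟨J, inferInstance, inferInstance,
    (Injective.ι (ModuleCat.of R X)).hom, (ModuleCat.mono_iff_injective _).1 inferInstance,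
    Module.injective_module_of_injective_object R _⟩

variable (R X) in
theorem exists_injective_copresentation :
    ∃ (I K : Type u) (_ : AddCommGroup I) (_ : Module R I) (_ : AddCommGroup K) (_ : Module R K)
      (i : X →ₗ[R] I) (p : I →ₗ[R] K), IsSES i p ∧ Module.Injective R I := by
  obtain ⟨I, _, _, i, hi, hI⟩ := exists_injective_embedding R X
  exact ⟨I, _, _, _, _, _, i, _, LinearMap.isSES_range hi, hI⟩

/-- The pushout of a short exact sequence. -/
theorem IsSES.exists_pushout {i : X →ₗ[R] E} {p : E →ₗ[R] C} (hs : IsSES i p) (k : X →ₗ[R] X') :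
    ∃ (Q : Type u) (_ : AddCommGroup Q) (_ : Module R Q) (j : X' →ₗ[R] Q) (l : E →ₗ[R] Q)
      (q : Q →ₗ[R] C), IsSES j q ∧ l ∘ₗ i = j ∘ₗ k ∧ q ∘ₗ l = p := by
  let T := LinearMap.range (k.prod (-i))
  refine ⟨(X' × E) ⧸ T, _, _, T.mkQ ∘ₗ LinearMap.inl R X' E, T.mkQ ∘ₗ LinearMap.inr R X' E,
    T.liftQ (p ∘ₗ LinearMap.snd R X' E) ?_, ⟨?_, ?_, ?_⟩, ?_, ?_⟩
  · rintro _ ⟨x, rfl⟩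
    simp [hs.exact.apply_apply_eq_zero]
  · rw [injective_iff_map_eq_zero]
    intro x hx
    obtain ⟨y, hy⟩ := (Submodule.Quotient.mk_eq_zero T).1 hx
    obtain ⟨h1, h2⟩ := Prod.ext_iff.1 hy
    have : y = 0 := hs.inj (by simpa using h2)
    subst this
    simpa using h1.symm
  · intro y
    obtain ⟨⟨a, b⟩, rfl⟩ := T.mkQ_surjective y
    constructor
    · intro h
      obtain ⟨x, rfl⟩ := (hs.exact b).1 h
      exact ⟨a + k x, (Submodule.Quotient.eq T).2 ⟨x, by simp⟩⟩
    · rintro ⟨x, hx⟩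
      rw [← hx]
      simp
  · intro c
    obtain ⟨b, rfl⟩ := hs.surj c
    exact ⟨T.mkQ (0, b), by simp⟩
  · ext x
    exact (Submodule.Quotient.eq T).2 ⟨-x, by simp⟩
  · ext x
    simp

/-- `Ext¹(C, X)` vanishes if all extensions of `C` by `X` have a retraction. -/
theorem ExtZero.of_retraction
    (h : ∀ (E : Type u) [AddCommGroup E] [Module R E] (i : X →ₗ[R] E) (p : E →ₗ[R] C),
      IsSES i p → ∃ r : E →ₗ[R] X, r ∘ₗ i = LinearMap.id) : ExtZero R C X := by
  obtain ⟨K, P, _, _, _, _, i, p, hs, hP⟩ := exists_projective_presentation R C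
  refine .of_extend hs .of_projective fun k => ?_
  -- A retraction of the pushout of the presentation along `k`, composed with `P → Q`, extends `k`
  -- to `P`.
  obtain ⟨Q, _, _, j, l, q, hq, h1, -⟩ := hs.exists_pushout k
  obtain ⟨r, hr⟩ := h Q j q hq
  exact ⟨r ∘ₗ l, by rw [LinearMap.comp_assoc, h1, ← LinearMap.comp_assoc, hr, LinearMap.id_comp]⟩

/-- `Ext¹(C, X)` vanishes if all extensions of `C` by `X` have a section. -/
theorem ExtZero.of_section
    (h : ∀ (E : Type u) [AddCommGroup E] [Module R E] (i : X →ₗ[R] E) (p : E →ₗ[R] C),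
      IsSES i p → ∃ s : C →ₗ[R] E, p ∘ₗ s = LinearMap.id) : ExtZero R C X := by
  refine .of_retraction fun E _ _ i p hs => ?_
  obtain ⟨s, hr⟩ := h E i p hs
  have H := (hs.exact.split_tfae' ).out 0 1
  exact (H.1 ⟨hs.inj, s, hr⟩).2

end ExtToolkit

/-! ### Right exactness of the tensor product, and the effect of `Tor₁ = 0`. -/

section Tensor

variable {A M X Y Z P : Type u} [Ring A] [AddCommGroup M] [Module Aᵐᵒᵖ M]
  [AddCommGroup X] [Module A X] [AddCommGroup Y] [Module A Y] [AddCommGroup Z] [Module A Z]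
  [AddCommGroup P] [Module A P]

namespace BalTensor

variable (M) in
/-- The map `M ⊗ g`. -/
abbrev lmap (g : X →ₗ[A] Y) : BalTensor A M X →+ BalTensor A M Y :=
  map (LinearMap.id : M →ₗ[Aᵐᵒᵖ] M) g

theorem lmap_tmul (g : X →ₗ[A] Y) (m : M) (x : X) : lmap M g (tmul A m x) = tmul A m (g x) := rfl

theorem lmap_comp (h : Y →ₗ[A] Z) (g : X →ₗ[A] Y) (t : BalTensor A M X) :
    lmap M (h ∘ₗ g) t = lmap M h (lmap M g t) :=
  DFunLike.congr_fun (f := lmap M (h ∘ₗ g)) (g := (lmap M h).comp (lmap M g))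
    (addHom_ext fun _ _ => rfl) t

theorem lmap_zero (t : BalTensor A M X) : lmap M (0 : X →ₗ[A] Y) t = 0 :=
  DFunLike.congr_fun (f := lmap M (0 : X →ₗ[A] Y)) (g := 0) (addHom_ext fun m _ => tmul_zero m) t

theorem lmap_surjective {p : Y →ₗ[A] Z} (hp : Function.Surjective p) :
    Function.Surjective (lmap M p) := by
  intro t
  induction t using induction_on with
  | zero => exact ⟨0, map_zero _⟩
  | tmul m x =>
    obtain ⟨y, rfl⟩ := hp x
    exact ⟨tmul A m y, rfl⟩
  | add s t hs ht =>
    obtain ⟨a, rfl⟩ := hs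
    obtain ⟨b, rfl⟩ := ht
    exact ⟨a + b, map_add _ _ _⟩

/-- `M ⊗ -` is right exact. -/
theorem lmap_exact {i : X →ₗ[A] Y} {p : Y →ₗ[A] Z} (he : Function.Exact i p)
    (hp : Function.Surjective p) : Function.Exact (lmap M i) (lmap M p) := by
  -- Exactness says that `(M ⊗ Y) / T → M ⊗ Z` is injective. A left inverse `σ` is built by choosing
  -- preimages under `p`; modulo `T` the choice does not matter, which is `hπ`.
  let T := (lmap M i).range
  let π : BalTensor A M Y →+ BalTensor A M Y ⧸ T := QuotientAddGroup.mk' T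
  have hπ : ∀ m y y', p y = p y' → π (tmul A m y) = π (tmul A m y') := by
    intro m y y' h
    obtain ⟨x, hx⟩ := (he (-y + y')).1 (by simp [h])
    refine QuotientAddGroup.eq.2 ⟨tmul A m x, ?_⟩
    rw [lmap_tmul, hx, tmul_add, ← neg_one_smul A y, ← smul_tmul, MulOpposite.op_neg, op_one, neg_one_smul,
      eq_neg_of_add_eq_zero_left (a := tmul A (-m) y) (b := tmul A m y)]
    rw [← add_tmul, neg_add_cancel, zero_tmul]
  let σ : BalTensor A M Z →+ BalTensor A M Y ⧸ T :=
    lift (AddMonoidHom.mk' (fun m => AddMonoidHom.mk'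
        (fun z => π (tmul A m (Function.surjInv hp z)))
        fun z z' => by
          rw [← map_add, ← tmul_add]
          apply hπ
          simp [Function.surjInv_eq hp])
      fun m m' => by
        ext z
        simp [add_tmul]) (by
      intro m a z
      simp only [AddMonoidHom.mk'_apply]
      rw [smul_tmul]
      apply hπ
      simp [Function.surjInv_eq hp])
  have hσ : ∀ t, σ (lmap M p t) = π t := fun t =>
    DFunLike.congr_fun (f := σ.comp (lmap M p)) (g := π)
      (addHom_ext fun m y => hπ m _ _ (Function.surjInv_eq hp _)) t
  intro t
  constructor
  · intro h
    have := hσ t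
    rw [h, map_zero] at this
    exact (QuotientAddGroup.eq_zero_iff t).1 this.symm
  · rintro ⟨s, rfl⟩
    rw [← lmap_comp, he.linearMap_comp_eq_zero, lmap_zero]

end BalTensor

open BalTensor

/-- For a projective resolution, `Tor₁ = 0` means that `M ⊗ P₂ → M ⊗ P₁ → M ⊗ P₀` is exact. An
element of `M ⊗ Ker p` lifts to `M ⊗ P₁`; if it dies in `M ⊗ P₀`, the lift comes from `M ⊗ P₂`, so
the element is zero because `P₂ → P₁ → Ker p` is zero. -/
theorem TorOneVanishes.exists_presentation (h : TorOneVanishes A M (ModuleCat.of A X)) :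
    ∃ (P : Type u) (_ : AddCommGroup P) (_ : Module A P) (p : P →ₗ[A] X),
      Module.Projective A P ∧ Function.Surjective p ∧
        Function.Injective (lmap M (LinearMap.ker p).subtype) := by
  let Q := projectiveResolution (ModuleCat.of A X)
  have h0 := h.of_iso (Q.isoLeftDerivedObj (functor A M) 1).symm
  have h1 : (((functor A M).mapHomologicalComplex _).obj Q.complex).ExactAt 1 :=
    (HomologicalComplex.exactAt_iff_isZero_homology _ _).2 h0
  rw [HomologicalComplex.exactAt_iff' _ 2 1 0 (by simp) (by simp), ShortComplex.ab_exact_iff] at h1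
  let p : Q.complex.X 0 →ₗ[A] X := (Q.π.f 0).hom
  let d : Q.complex.X 1 →ₗ[A] Q.complex.X 0 := (Q.complex.d 1 0).hom
  let d' : Q.complex.X 2 →ₗ[A] Q.complex.X 1 := (Q.complex.d 2 1).hom
  have hp : Function.Surjective p := (ModuleCat.epi_iff_surjective _).1 inferInstance
  have hdp : Function.Exact d p :=
    (ShortComplex.ShortExact.moduleCat_exact_iff_function_exact _).1 Q.exact₀
  have hdd : Function.Exact d' d :=
    (ShortComplex.ShortExact.moduleCat_exact_iff_function_exact _).1 (Q.exact_succ 0)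
  refine ⟨Q.complex.X 0, inferInstance, inferInstance, p, ?_, hp, ?_⟩
  · exact (IsProjective.iff_projective (R := A) _).2 (Q.projective 0)
  let d₁ : Q.complex.X 1 →ₗ[A] LinearMap.ker p := d.codRestrict _ hdp.apply_apply_eq_zero
  have hd₁ : Function.Surjective d₁ := by
    rintro ⟨y, hy⟩
    obtain ⟨z, rfl⟩ := (hdp y).1 hy
    exact ⟨z, rfl⟩
  rw [injective_iff_map_eq_zero]
  intro t ht
  obtain ⟨s, rfl⟩ := lmap_surjective hd₁ t
  rw [← lmap_comp] at ht
  obtain ⟨r, hr⟩ : ∃ r : BalTensor A M (Q.complex.X 2), lmap M d' r = s := h1 s ht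
  rw [← hr, ← lmap_comp]
  convert lmap_zero r
  ext x
  exact hdd.apply_apply_eq_zero x

/-- If `Tor₁(M, Z) = 0` then `M ⊗ -` preserves exactness of `0 → X → Y → Z → 0`. -/
theorem TorOneVanishes.lmap_injective (h : TorOneVanishes A M (ModuleCat.of A Z))
    {i : X →ₗ[A] Y} {p : Y →ₗ[A] Z} (hs : IsSES i p) : Function.Injective (lmap M i) := by
  obtain ⟨P, _, _, q, hP, hq, hinj⟩ := h.exists_presentation
  obtain ⟨l, hl⟩ := Module.projective_lifting_property p q hs.surj
  -- `K → X × P → Y`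
  have hK : ∀ k : LinearMap.ker q, ∃ x, i x = l k := fun k =>
    (hs.exact _).1 (by rw [← LinearMap.comp_apply, hl, k.2])
  let c : LinearMap.ker q →ₗ[A] X :=
    (LinearEquiv.ofInjective i hs.inj).symm.toLinearMap ∘ₗ
      (l ∘ₗ (LinearMap.ker q).subtype).codRestrict (LinearMap.range i) hK
  have hc : ∀ k, i (c k) = l k := fun k =>
    congrArg Subtype.val ((LinearEquiv.ofInjective i hs.inj).apply_symm_apply ⟨l k, hK k⟩)
  let a : LinearMap.ker q →ₗ[A] X × P := (-c).prod (LinearMap.ker q).subtype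
  let b : X × P →ₗ[A] Y := i.coprod l
  have hab : Function.Exact a b := by
    rintro ⟨x, y⟩
    constructor
    · intro hxy
      have h2 : i x + l y = 0 := hxy
      have hy : q y = 0 := by
        rw [← hl, LinearMap.comp_apply, eq_neg_of_add_eq_zero_right h2, map_neg,
          hs.exact.apply_apply_eq_zero, neg_zero]
      refine ⟨⟨y, hy⟩, Prod.ext (hs.inj ?_) rfl⟩
      change i (-c ⟨y, hy⟩) = i x
      rw [map_neg, hc, eq_neg_of_add_eq_zero_left h2]
    · rintro ⟨k, hk⟩
      rw [← hk]
      change i (-c k) + l k = 0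
      rw [map_neg, hc, neg_add_cancel]
  have hb : Function.Surjective b := by
    intro y
    obtain ⟨z, hz⟩ := hq (p y)
    obtain ⟨x, hx⟩ := (hs.exact (y - l z)).1 (by
      rw [map_sub, ← hz, ← hl, LinearMap.comp_apply, sub_self])
    exact ⟨(x, z), by change i x + l z = y; rw [hx, sub_add_cancel]⟩
  rw [injective_iff_map_eq_zero]
  intro t ht
  -- As `K → X × P → Y → 0` stays exact under `M ⊗ -`, the element `(t, 0)` comes from some `s` in
  -- `M ⊗ K`. Its second component says that `s` dies in `M ⊗ P`, so `s = 0` by the choice of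
  -- presentation, and then the first component gives `t = 0`.
  obtain ⟨s, hs'⟩ := (lmap_exact (M := M) hab hb (lmap M (LinearMap.inl A X P) t)).1 (by
    rw [← lmap_comp, LinearMap.coprod_inl, ht])
  have h0 : s = 0 := by
    refine hinj ?_
    rw [map_zero]
    have := congrArg (lmap M (LinearMap.snd A X P)) hs'
    rw [← lmap_comp, ← lmap_comp, LinearMap.snd_comp_inl, lmap_zero] at this
    exact this
  have := congrArg (lmap M (LinearMap.fst A X P)) hs'
  rw [h0, map_zero, map_zero, ← lmap_comp, LinearMap.fst_comp_inl] at this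
  exact (this.trans (DFunLike.congr_fun (f := lmap M (LinearMap.id : X →ₗ[A] X))
    (g := AddMonoidHom.id _) (addHom_ext fun _ _ => rfl) t)).symm

end Tensor

/-! ### The functors `M ⊗_A -` and `Hom_A(N, -)` with values in `B`-modules. -/

section Bimodule

variable {A B M N X X' X'' P Y : Type u} [Ring A] [Ring B]
  [AddCommGroup M] [Module B M] [Module Aᵐᵒᵖ M] [SMulCommClass B Aᵐᵒᵖ M]
  [AddCommGroup N] [Module A N] [Module Bᵐᵒᵖ N] [SMulCommClass A Bᵐᵒᵖ N]
  [AddCommGroup X] [Module A X] [AddCommGroup X'] [Module A X'] [AddCommGroup X''] [Module A X'']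
  [AddCommGroup P] [Module B P] [AddCommGroup Y] [Module B Y]

namespace BalTensor

/-- A biadditive balanced map which is linear in the first variable, as a linear map on the tensor
product. -/
def linLift (f : M →+ X →+ P) (hf : ∀ (m : M) (a : A) (x : X), f (op a • m) x = f m (a • x))
    (hb : ∀ (b : B) (m : M) (x : X), f (b • m) x = b • f m x) : BalTensor A M X →ₗ[B] P where
  __ := lift f hf
  map_smul' b t := by
    induction t using induction_on with
    | zero => simp
    | add s t hs ht => simp_all
    | tmul m x => exact hb b m x

theorem linHom_ext {f g : BalTensor A M X →ₗ[B] P}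
    (h : ∀ m x, f (tmul A m x) = g (tmul A m x)) : f = g :=
  LinearMap.toAddMonoidHom_injective (addHom_ext h)

variable (B M) in
/-- The `B`-linear map `M ⊗ u` for a `B`-`A`-bimodule `M`. -/
def lTensor (u : X →ₗ[A] X') : BalTensor A M X →ₗ[B] BalTensor A M X' where
  __ := lmap M u
  map_smul' b t := by
    induction t using induction_on with
    | zero => simp
    | add s t hs ht => simp_all
    | tmul m x => rfl

@[simp]
theorem lTensor_tmul (u : X →ₗ[A] X') (m : M) (x : X) :
    lTensor B M u (tmul A m x) = tmul A m (u x) := rfl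

theorem lTensor_comp (v : X' →ₗ[A] X'') (u : X →ₗ[A] X') :
    lTensor B M (v ∘ₗ u) = lTensor B M v ∘ₗ lTensor B M u := linHom_ext fun _ _ => rfl

theorem lTensor_id : lTensor B M (LinearMap.id : X →ₗ[A] X) = LinearMap.id :=
  linHom_ext fun _ _ => rfl

theorem isSES_lTensor {Z : Type u} [AddCommGroup Z] [Module A Z] {i : X →ₗ[A] X'}
    {p : X' →ₗ[A] Z} (h : TorOneVanishes A M (ModuleCat.of A Z)) (hs : IsSES i p) :
    IsSES (lTensor B M i) (lTensor B M p) :=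
  ⟨h.lmap_injective hs, lmap_exact hs.exact hs.surj, lmap_surjective hs.surj⟩

end BalTensor

namespace HomLeft

/-- A linear map `N → X` as an element of the left `B`-module `Hom_A(N, X)`. -/
def ofLinearMap (l : N →ₗ[A] X) : HomLeft A N X := l

/-- The underlying linear map of an element of `Hom_A(N, X)`. -/
def toLinearMap (h : HomLeft A N X) : N →ₗ[A] X := h

@[simp] theorem ofLinearMap_apply (l : N →ₗ[A] X) (n : N) : ofLinearMap l n = l n := rfl
@[simp] theorem toLinearMap_apply (h : HomLeft A N X) (n : N) : h.toLinearMap n = h n := rfl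
@[simp] theorem add_apply (h k : HomLeft A N X) (n : N) : (h + k) n = h n + k n := rfl
@[simp] theorem zero_apply (n : N) : (0 : HomLeft A N X) n = 0 := rfl
@[simp] theorem map_add' (h : HomLeft A N X) (n n' : N) : h (n + n') = h n + h n' :=
  h.toLinearMap.map_add n n'
@[simp] theorem map_zero' (h : HomLeft A N X) : h 0 = 0 := h.toLinearMap.map_zero
@[simp] theorem map_smul' (h : HomLeft A N X) (a : A) (n : N) : h (a • n) = a • h n :=
  h.toLinearMap.map_smul a n

variable (B N) in
/-- The `B`-linear map `Hom_A(N, u)`. -/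
def postcomp (u : X →ₗ[A] X') : HomLeft A N X →ₗ[B] HomLeft A N X' where
  toFun h := ofLinearMap (u ∘ₗ h.toLinearMap)
  map_add' _ _ := ext fun _ => u.map_add _ _
  map_smul' _ _ := rfl

@[simp]
theorem postcomp_apply (u : X →ₗ[A] X') (h : HomLeft A N X) (n : N) :
    postcomp B N u h n = u (h n) := rfl

theorem isSES_postcomp {i : X →ₗ[A] X'} {p : X' →ₗ[A] X''} (h : ExtZero A N X)
    (hs : IsSES i p) : IsSES (postcomp B N i) (postcomp B N p) where
  inj h k e := ext fun n => hs.inj (DFunLike.congr_fun e n)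
  exact h := by
    constructor
    · intro e
      have he : ∀ n, ∃ x, i x = h n := fun n => (hs.exact _).1 (DFunLike.congr_fun e n)
      refine ⟨ofLinearMap ((LinearEquiv.ofInjective i hs.inj).symm.toLinearMap ∘ₗ
        h.toLinearMap.codRestrict (LinearMap.range i) he), ext fun n => ?_⟩
      exact congrArg Subtype.val ((LinearEquiv.ofInjective i hs.inj).apply_symm_apply ⟨h n, he n⟩)
    · rintro ⟨k, rfl⟩
      exact ext fun n => hs.exact.apply_apply_eq_zero _
  surj k := by
    obtain ⟨l, hl⟩ := h.lift hs k.toLinearMap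
    exact ⟨ofLinearMap l, hl⟩

end HomLeft

/-! ### Modules over the Morita ring as factorizations of `κ` when `M ⊗_A N = 0`. -/

namespace MoritaContext

variable (D : MoritaContext A B M N)

variable (X) in
/-- The map `M ⊗_A X → Hom_A(N, X)`, `m ⊗ x ↦ (n ↦ ψ(n ⊗ m) x)`. -/
def kappa : BalTensor A M X →ₗ[B] HomLeft A N X :=
  BalTensor.linLift
    (AddMonoidHom.mk' (fun m => AddMonoidHom.mk' (fun x => HomLeft.ofLinearMap
        { toFun := fun n => D.ψ (BalTensor.tmul B n m) • x
          map_add' := fun n n' => by rw [BalTensor.add_tmul, map_add, add_smul]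
          map_smul' := fun a n => by rw [MoritaRing.ψ_smul, mul_smul, RingHom.id_apply] })
        fun x y => HomLeft.ext fun n => smul_add _ _ _)
      fun m m' => AddMonoidHom.ext fun x => HomLeft.ext fun n => by
        simp [BalTensor.tmul_add, add_smul])
    (fun m a x => HomLeft.ext fun n => by simp [D.ψ_right, mul_smul])
    (fun b m x => HomLeft.ext fun n => by
      rw [HomLeft.smul_apply]
      simp [BalTensor.smul_tmul])

@[simp]
theorem kappa_tmul (m : M) (x : X) (n : N) :
    D.kappa X (BalTensor.tmul A m x) n = D.ψ (BalTensor.tmul B n m) • x := rfl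

theorem kappa_natural (u : X →ₗ[A] X') :
    HomLeft.postcomp B N u ∘ₗ D.kappa X = D.kappa X' ∘ₗ BalTensor.lTensor B M u :=
  BalTensor.linHom_ext fun m x => HomLeft.ext fun n => by simp

theorem kappa_natural_apply (u : X →ₗ[A] X') (t : BalTensor A M X) :
    HomLeft.postcomp B N u (D.kappa X t) = D.kappa X' (BalTensor.lTensor B M u t) :=
  LinearMap.congr_fun (D.kappa_natural u) t

variable (X Y) in
/-- The data describing a module over the Morita ring with components `X` and `Y` when
`M ⊗_A N = 0`: the structure map `f` and the adjoint `k` of the structure map `g`. -/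
structure Quad where
  f : BalTensor A M X →ₗ[B] Y
  k : Y →ₗ[B] HomLeft A N X
  k_f : ∀ t, k (f t) = D.kappa X t

namespace Quad

variable {D} {X Y X' Y' X'' Y'' : Type u} [AddCommGroup X] [Module A X] [AddCommGroup Y] [Module B Y]
  [AddCommGroup X'] [Module A X'] [AddCommGroup Y'] [Module B Y']
  [AddCommGroup X''] [Module A X''] [AddCommGroup Y''] [Module B Y'']

/-- The module over the Morita ring with components `X` and `Y`. -/
@[ext]
structure Carrier (s : D.Quad X Y) : Type u where
  top : X
  bot : Y

variable (s : D.Quad X Y) (t : D.Quad X' Y') (r : D.Quad X'' Y'')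

namespace Carrier

variable {s}

instance : Add s.Carrier := ⟨fun x y => ⟨x.top + y.top, x.bot + y.bot⟩⟩
instance : Zero s.Carrier := ⟨⟨0, 0⟩⟩
instance : Neg s.Carrier := ⟨fun x => ⟨-x.top, -x.bot⟩⟩

@[simp] theorem add_top (x y : s.Carrier) : (x + y).top = x.top + y.top := rfl
@[simp] theorem add_bot (x y : s.Carrier) : (x + y).bot = x.bot + y.bot := rfl
@[simp] theorem zero_top : (0 : s.Carrier).top = 0 := rfl
@[simp] theorem zero_bot : (0 : s.Carrier).bot = 0 := rfl
@[simp] theorem neg_top (x : s.Carrier) : (-x).top = -x.top := rfl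
@[simp] theorem neg_bot (x : s.Carrier) : (-x).bot = -x.bot := rfl

instance : AddCommGroup s.Carrier where
  add_assoc x y z := by ext <;> simp [add_assoc]
  zero_add x := by ext <;> simp
  add_zero x := by ext <;> simp
  add_comm x y := by ext <;> simp [add_comm]
  neg_add_cancel x := by ext <;> simp
  nsmul := nsmulRec
  zsmul := zsmulRec

instance : SMul (MoritaRing D) s.Carrier :=
  ⟨fun r w => ⟨r.a • w.top + s.k w.bot r.n, s.f (BalTensor.tmul A r.m w.top) + r.b • w.bot⟩⟩

@[simp] theorem smul_top (r : MoritaRing D) (w : s.Carrier) :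
    (r • w).top = r.a • w.top + s.k w.bot r.n := rfl
@[simp] theorem smul_bot (r : MoritaRing D) (w : s.Carrier) :
    (r • w).bot = s.f (BalTensor.tmul A r.m w.top) + r.b • w.bot := rfl

/-- The element is the image of `m ⊗ n`, which lies in `M ⊗_A N = 0`, under `M ⊗ h`. -/
theorem tmul_homLeft_eq_zero [Subsingleton (BalTensor A M N)] (m : M) (h : HomLeft A N X) (n : N) :
    BalTensor.tmul A m (h n) = 0 := by
  change BalTensor.lmap M h.toLinearMap (BalTensor.tmul A m n) = 0
  rw [Subsingleton.elim (BalTensor.tmul A m n) 0, map_zero]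

theorem k_f_apply (m : M) (x : X) (n : N) :
    s.k (s.f (BalTensor.tmul A m x)) n = D.ψ (BalTensor.tmul B n m) • x := by
  rw [s.k_f, kappa_tmul]

/-- Associativity in the first component is the identity `k ∘ f = κ`. In the second component it
requires `f(m ⊗ n y) = φ(m ⊗ n) y`, where both sides vanish because `M ⊗_A N = 0`. -/
instance [Subsingleton (BalTensor A M N)] : Module (MoritaRing D) s.Carrier where
  one_smul w := by ext <;> simp
  mul_smul r r' w := by
    ext
    · simp only [smul_top, smul_bot, MoritaRing.mul_a, MoritaRing.mul_n, map_add, map_smul, add_smul, smul_add,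
        HomLeft.map_add', HomLeft.map_smul', HomLeft.add_apply, HomLeft.smul_apply, k_f_apply,
        mul_smul]
      abel
    · simp only [smul_top, smul_bot, MoritaRing.mul_m, MoritaRing.mul_b, map_add, add_smul, smul_add,
        BalTensor.add_tmul, BalTensor.tmul_add, tmul_homLeft_eq_zero, map_zero, mul_smul,
        Subsingleton.elim (BalTensor.tmul A r.m r'.n) 0, BalTensor.smul_tmul, zero_smul,
        ← BalTensor.smul_def, map_smul]
      abel
  smul_zero r := by ext <;> simp
  smul_add r w w' := by
    ext
    · simp; abel
    · simp [BalTensor.tmul_add]; abel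
  add_smul r r' w := by
    ext
    · simp [add_smul]; abel
    · simp [BalTensor.add_tmul, add_smul]; abel
  zero_smul w := by ext <;> simp

end Carrier

variable [Subsingleton (BalTensor A M N)]

variable {s t r}

/-- The homomorphism with components `u` and `v`. -/
def hom (u : X →ₗ[A] X') (v : Y →ₗ[B] Y')
    (hf : v ∘ₗ s.f = t.f ∘ₗ BalTensor.lTensor B M u)
    (hk : t.k ∘ₗ v = HomLeft.postcomp B N u ∘ₗ s.k) :
    s.Carrier →ₗ[MoritaRing D] t.Carrier where
  toFun w := ⟨u w.top, v w.bot⟩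
  map_add' w w' := by ext <;> simp
  map_smul' c w := by
    ext
    · have := DFunLike.congr_fun (LinearMap.congr_fun hk w.bot) c.n
      simp only [LinearMap.comp_apply, HomLeft.postcomp_apply] at this
      simp [this]
    · have := LinearMap.congr_fun hf (BalTensor.tmul A c.m w.top)
      simp only [LinearMap.comp_apply, BalTensor.lTensor_tmul] at this
      simp [this]

/-- `F` commutes with the idempotent `e₁`, which kills second components. -/
theorem map_top_bot (F : s.Carrier →ₗ[MoritaRing D] t.Carrier) (x : X) : (F ⟨x, 0⟩).bot = 0 := by
  have h : (⟨x, 0⟩ : s.Carrier) = D.e₁ • ⟨x, 0⟩ := by ext <;> simp [e₁]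
  rw [h, map_smul]
  simp [e₁]

theorem map_bot_top (F : s.Carrier →ₗ[MoritaRing D] t.Carrier) (y : Y) : (F ⟨0, y⟩).top = 0 := by
  have h : (⟨0, y⟩ : s.Carrier) = D.e₂ • ⟨0, y⟩ := by ext <;> simp [e₂]
  rw [h, map_smul]
  simp [e₂]

/-- The first component of a homomorphism. -/
def topHom (F : s.Carrier →ₗ[MoritaRing D] t.Carrier) : X →ₗ[A] X' where
  toFun x := (F ⟨x, 0⟩).top
  map_add' x y := by
    rw [← Carrier.add_top, ← map_add]
    congr 2
    ext <;> simp
  map_smul' a x := by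
    have h : (⟨a • x, 0⟩ : s.Carrier) = (⟨a, 0, 0, 0⟩ : MoritaRing D) • ⟨x, 0⟩ := by
      ext <;> simp
    rw [h, map_smul]
    simp

/-- The second component of a homomorphism. -/
def botHom (F : s.Carrier →ₗ[MoritaRing D] t.Carrier) : Y →ₗ[B] Y' where
  toFun y := (F ⟨0, y⟩).bot
  map_add' x y := by
    rw [← Carrier.add_bot, ← map_add]
    congr 2
    ext <;> simp
  map_smul' b y := by
    have h : (⟨0, b • y⟩ : s.Carrier) = (⟨0, 0, 0, b⟩ : MoritaRing D) • ⟨0, y⟩ := by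
      ext <;> simp
    rw [h, map_smul]
    simp

theorem apply_eq (F : s.Carrier →ₗ[MoritaRing D] t.Carrier) (w : s.Carrier) :
    F w = ⟨topHom F w.top, botHom F w.bot⟩ := by
  have h : w = ⟨w.top, 0⟩ + ⟨0, w.bot⟩ := by ext <;> simp
  rw [h, map_add]
  ext
  · simp [map_bot_top, topHom]
  · simp [map_top_bot, botHom]

theorem hom_ext {F G : s.Carrier →ₗ[MoritaRing D] t.Carrier} (h₁ : topHom F = topHom G)
    (h₂ : botHom F = botHom G) : F = G :=
  LinearMap.ext fun w => by rw [apply_eq F, apply_eq G, h₁, h₂]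

theorem botHom_f_apply (F : s.Carrier →ₗ[MoritaRing D] t.Carrier) (z : BalTensor A M X) :
    botHom F (s.f z) = t.f (BalTensor.lTensor B M (topHom F) z) := by
  induction z using BalTensor.induction_on with
  | zero => simp
  | add a b ha hb => simp [ha, hb]
  | tmul m x =>
    have h : (⟨0, s.f (BalTensor.tmul A m x)⟩ : s.Carrier) =
        (⟨0, 0, m, 0⟩ : MoritaRing D) • ⟨x, 0⟩ := by
      ext <;> simp
    have h1 := congrArg Carrier.bot (congrArg F h)
    rw [map_smul, Carrier.smul_bot, zero_smul, add_zero] at h1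
    exact h1

theorem botHom_f (F : s.Carrier →ₗ[MoritaRing D] t.Carrier) :
    botHom F ∘ₗ s.f = t.f ∘ₗ BalTensor.lTensor B M (topHom F) :=
  LinearMap.ext (botHom_f_apply F)

theorem k_botHom_apply (F : s.Carrier →ₗ[MoritaRing D] t.Carrier) (y : Y) :
    t.k (botHom F y) = HomLeft.postcomp B N (topHom F) (s.k y) := by
  ext n
  have h : (⟨s.k y n, 0⟩ : s.Carrier) = (⟨0, n, 0, 0⟩ : MoritaRing D) • ⟨0, y⟩ := by
    ext <;> simp
  have h1 := congrArg Carrier.top (congrArg F h)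
  rw [map_smul, Carrier.smul_top, zero_smul, zero_add] at h1
  exact h1.symm

theorem k_botHom (F : s.Carrier →ₗ[MoritaRing D] t.Carrier) :
    t.k ∘ₗ botHom F = HomLeft.postcomp B N (topHom F) ∘ₗ s.k :=
  LinearMap.ext (k_botHom_apply F)

@[simp]
theorem topHom_comp (G : t.Carrier →ₗ[MoritaRing D] r.Carrier)
    (F : s.Carrier →ₗ[MoritaRing D] t.Carrier) : topHom (G ∘ₗ F) = topHom G ∘ₗ topHom F := by
  ext x
  change (G (F ⟨x, 0⟩)).top = _
  rw [apply_eq F, apply_eq G]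
  rfl

@[simp]
theorem botHom_comp (G : t.Carrier →ₗ[MoritaRing D] r.Carrier)
    (F : s.Carrier →ₗ[MoritaRing D] t.Carrier) : botHom (G ∘ₗ F) = botHom G ∘ₗ botHom F := by
  ext x
  change (G (F ⟨0, x⟩)).bot = _
  rw [apply_eq F, apply_eq G]
  rfl

@[simp]
theorem topHom_id : topHom (LinearMap.id : s.Carrier →ₗ[MoritaRing D] s.Carrier) = LinearMap.id :=
  rfl

/-- By `apply_eq` a homomorphism acts separately on the two components, so elements can be tested
one component at a time. -/
theorem isSES_iff {F : s.Carrier →ₗ[MoritaRing D] t.Carrier}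
    {G : t.Carrier →ₗ[MoritaRing D] r.Carrier} :
    IsSES F G ↔ IsSES (topHom F) (topHom G) ∧ IsSES (botHom F) (botHom G) := by
  constructor
  · intro h
    refine ⟨⟨fun x y e => ?_, fun x => ⟨fun e => ?_, ?_⟩, fun x => ?_⟩,
      ⟨fun x y e => ?_, fun x => ⟨fun e => ?_, ?_⟩, fun x => ?_⟩⟩
    · refine congrArg Carrier.top (h.inj (a₁ := ⟨x, 0⟩) (a₂ := ⟨y, 0⟩) ?_)
      simp [apply_eq F, e]
    · obtain ⟨w, hw⟩ := (h.exact ⟨x, 0⟩).1 (by rw [apply_eq G]; ext <;> simp [e])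
      rw [apply_eq] at hw
      exact ⟨w.top, congrArg Carrier.top hw⟩
    · rintro ⟨y, rfl⟩
      have := h.exact.apply_apply_eq_zero ⟨y, 0⟩
      rw [apply_eq F, apply_eq G] at this
      exact congrArg Carrier.top this
    · obtain ⟨w, hw⟩ := h.surj ⟨x, 0⟩
      rw [apply_eq] at hw
      exact ⟨w.top, congrArg Carrier.top hw⟩
    · refine congrArg Carrier.bot (h.inj (a₁ := ⟨0, x⟩) (a₂ := ⟨0, y⟩) ?_)
      simp [apply_eq F, e]
    · obtain ⟨w, hw⟩ := (h.exact ⟨0, x⟩).1 (by rw [apply_eq G]; ext <;> simp [e])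
      rw [apply_eq] at hw
      exact ⟨w.bot, congrArg Carrier.bot hw⟩
    · rintro ⟨y, rfl⟩
      have := h.exact.apply_apply_eq_zero ⟨0, y⟩
      rw [apply_eq F, apply_eq G] at this
      exact congrArg Carrier.bot this
    · obtain ⟨w, hw⟩ := h.surj ⟨0, x⟩
      rw [apply_eq] at hw
      exact ⟨w.bot, congrArg Carrier.bot hw⟩
  · rintro ⟨h₁, h₂⟩
    refine ⟨fun x y e => ?_, fun x => ⟨fun e => ?_, ?_⟩, fun x => ?_⟩
    · rw [apply_eq F x, apply_eq F y] at e
      have e₁ : topHom F x.top = topHom F y.top := (Carrier.ext_iff.1 e).1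
      have e₂ : botHom F x.bot = botHom F y.bot := (Carrier.ext_iff.1 e).2
      exact Carrier.ext (h₁.inj e₁) (h₂.inj e₂)
    · rw [apply_eq G] at e
      obtain ⟨y, hy⟩ := (h₁.exact _).1 (congrArg Carrier.top e)
      obtain ⟨z, hz⟩ := (h₂.exact _).1 (congrArg Carrier.bot e)
      exact ⟨⟨y, z⟩, by rw [apply_eq F, hy, hz]⟩
    · rintro ⟨y, rfl⟩
      rw [apply_eq F, apply_eq G]
      exact Carrier.ext (h₁.exact.apply_apply_eq_zero _) (h₂.exact.apply_apply_eq_zero _)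
    · obtain ⟨y, hy⟩ := h₁.surj x.top
      obtain ⟨z, hz⟩ := h₂.surj x.bot
      exact ⟨⟨y, z⟩, by rw [apply_eq G, hy, hz]⟩

end Quad

section OfModule

variable (W : Type u) [AddCommGroup W] [Module (MoritaRing D) W]

/-- The data describing a given module over the Morita ring. -/
def quadOf : D.Quad (D.Top W) (D.Bot W) where
  f := D.f W
  k := D.gTilde W
  k_f t := by
    induction t using BalTensor.induction_on with
    | zero => simp
    | add a b ha hb => simp [ha, hb]
    | tmul m x =>
      refine HomLeft.ext fun n => D.topVal_injective ?_
      change (⟨0, n, 0, 0⟩ : MoritaRing D) • (⟨0, 0, m, 0⟩ : MoritaRing D) • D.topVal x =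
        (⟨D.ψ (BalTensor.tmul B n m), 0, 0, 0⟩ : MoritaRing D) • D.topVal x
      rw [smul_smul]
      congr 1
      ext <;> simp

theorem e₁_mul_e₁ : D.e₁ * D.e₁ = D.e₁ := by ext <;> simp [e₁]
theorem e₂_mul_e₂ : D.e₂ * D.e₂ = D.e₂ := by ext <;> simp [e₂]
theorem e₁_mul_e₂ : D.e₁ * D.e₂ = 0 := by ext <;> simp [e₁, e₂]
theorem e₂_mul_e₁ : D.e₂ * D.e₁ = 0 := by ext <;> simp [e₁, e₂]
theorem e₁_add_e₂ : D.e₁ + D.e₂ = 1 := by ext <;> simp [e₁, e₂]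

theorem e₁_smul_botVal (y : D.Bot W) : D.e₁ • D.botVal y = 0 := by
  rw [← e₂_smul_botVal, smul_smul, e₁_mul_e₂, zero_smul]

theorem e₂_smul_topVal (x : D.Top W) : D.e₂ • D.topVal x = 0 := by
  rw [← e₁_smul_topVal, smul_smul, e₂_mul_e₁, zero_smul]

variable [Subsingleton (BalTensor A M N)]

/-- A module over the Morita ring is isomorphic to the one given by its data. -/
def equivQuadOf : (D.quadOf W).Carrier ≃ₗ[MoritaRing D] W where
  toFun w := D.topVal w.top + D.botVal w.bot
  map_add' w w' := by
    simp only [Quad.Carrier.add_top, Quad.Carrier.add_bot, map_add]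
    abel
  map_smul' c w := by
    change (⟨c.a, 0, 0, 0⟩ : MoritaRing D) • D.topVal w.top +
        (⟨0, c.n, 0, 0⟩ : MoritaRing D) • D.botVal w.bot +
      ((⟨0, 0, c.m, 0⟩ : MoritaRing D) • D.topVal w.top +
        (⟨0, 0, 0, c.b⟩ : MoritaRing D) • D.botVal w.bot) =
      c • (D.topVal w.top + D.botVal w.bot)
    -- Of the eight products of an entry of `c` with a component of `w`, the four with mismatched
    -- columns vanish, since the entry times the idempotent of that component is zero.
    have h1 : (⟨0, c.n, 0, 0⟩ : MoritaRing D) • D.topVal w.top = 0 := by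
      rw [← e₁_smul_topVal, smul_smul]
      convert zero_smul (MoritaRing D) (D.topVal w.top)
      ext <;> simp [e₁]
    have h2 : (⟨0, 0, 0, c.b⟩ : MoritaRing D) • D.topVal w.top = 0 := by
      rw [← e₁_smul_topVal, smul_smul]
      convert zero_smul (MoritaRing D) (D.topVal w.top)
      ext <;> simp [e₁]
    have h3 : (⟨c.a, 0, 0, 0⟩ : MoritaRing D) • D.botVal w.bot = 0 := by
      rw [← e₂_smul_botVal, smul_smul]
      convert zero_smul (MoritaRing D) (D.botVal w.bot)
      ext <;> simp [e₂]
    have h4 : (⟨0, 0, c.m, 0⟩ : MoritaRing D) • D.botVal w.bot = 0 := by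
      rw [← e₂_smul_botVal, smul_smul]
      convert zero_smul (MoritaRing D) (D.botVal w.bot)
      ext <;> simp [e₂]
    have h5 : c = ⟨c.a, 0, 0, 0⟩ + ⟨0, c.n, 0, 0⟩ + ⟨0, 0, c.m, 0⟩ + ⟨0, 0, 0, c.b⟩ := by
      ext <;> simp
    conv_rhs => rw [h5]
    simp only [smul_add, add_smul, h1, h2, h3, h4]
    abel
  invFun w := ⟨D.topMk (D.e₁ • w) (by rw [smul_smul, e₁_mul_e₁]),
    D.botMk (D.e₂ • w) (by rw [smul_smul, e₂_mul_e₂])⟩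
  left_inv w := by
    apply Quad.Carrier.ext
    · apply D.topVal_injective
      simp [e₁_smul_topVal, e₁_smul_botVal]
    · apply D.botVal_injective
      simp [e₂_smul_topVal, e₂_smul_botVal]
  right_inv w := by
    change D.e₁ • w + D.e₂ • w = w
    rw [← add_smul, e₁_add_e₂, one_smul]

end OfModule

namespace Quad

variable {D} {X Y : Type u} [AddCommGroup X] [Module A X] [AddCommGroup Y] [Module B Y]
  (s : D.Quad X Y) [Subsingleton (BalTensor A M N)]

/-- The first component of the module given by the data `s`. -/
def topEquiv : D.Top s.Carrier ≃ₗ[A] X where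
  toFun x := (D.topVal x).top
  map_add' x y := by simp
  map_smul' a x := by
    change ((⟨a, 0, 0, 0⟩ : MoritaRing D) • D.topVal x).top = _
    simp
  invFun x := D.topMk ⟨x, 0⟩ (by ext <;> simp [e₁])
  left_inv x := by
    apply D.topVal_injective
    rw [topVal_topMk]
    refine Carrier.ext rfl ?_
    rw [← D.e₁_smul_topVal x]
    simp [e₁]
  right_inv x := rfl

/-- The second component of the module given by the data `s`. -/
def botEquiv : D.Bot s.Carrier ≃ₗ[B] Y where
  toFun x := (D.botVal x).bot
  map_add' x y := by simp
  map_smul' b x := by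
    change ((⟨0, 0, 0, b⟩ : MoritaRing D) • D.botVal x).bot = _
    simp
  invFun x := D.botMk ⟨0, x⟩ (by ext <;> simp [e₂])
  left_inv x := by
    apply D.botVal_injective
    rw [botVal_botMk]
    refine Carrier.ext ?_ rfl
    rw [← D.e₂_smul_botVal x]
    simp [e₂]
  right_inv x := rfl

theorem botEquiv_f (t : BalTensor A M (D.Top s.Carrier)) :
    s.botEquiv (D.f s.Carrier t) = s.f (BalTensor.lTensor B M s.topEquiv.toLinearMap t) := by
  induction t using BalTensor.induction_on with
  | zero => simp
  | add a b ha hb => simp [ha, hb]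
  | tmul m x =>
    change ((⟨0, 0, m, 0⟩ : MoritaRing D) • D.topVal x).bot = _
    simp
    rfl

theorem gTilde_eq (y : D.Bot s.Carrier) :
    HomLeft.postcomp B N s.topEquiv.toLinearMap (D.gTilde s.Carrier y) = s.k (s.botEquiv y) := by
  ext n
  change ((⟨0, n, 0, 0⟩ : MoritaRing D) • D.botVal y).top = _
  simp
  rfl

end Quad

end MoritaContext

end Bimodule

/-! ### Factoring maps through kernels and cokernels. -/

section Factor

variable {R : Type u} [Ring R] {C E X X' : Type u}
  [AddCommGroup C] [Module R C] [AddCommGroup E] [Module R E] [AddCommGroup X] [Module R X]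
  [AddCommGroup X'] [Module R X'] {i : X →ₗ[R] E} {p : E →ₗ[R] C}

theorem IsSES.exists_desc (hs : IsSES i p) (k : E →ₗ[R] X') (hk : k ∘ₗ i = 0) :
    ∃ l : C →ₗ[R] X', l ∘ₗ p = k := by
  have hker : LinearMap.ker p ≤ LinearMap.ker k := by
    intro e he
    obtain ⟨x, rfl⟩ := (hs.exact e).1 he
    exact LinearMap.congr_fun hk x
  refine ⟨(LinearMap.ker p).liftQ k hker ∘ₗ (p.quotKerEquivOfSurjective hs.surj).symm.toLinearMap,
    LinearMap.ext fun e => ?_⟩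
  have : (p.quotKerEquivOfSurjective hs.surj).symm (p e) = (LinearMap.ker p).mkQ e := by
    rw [LinearEquiv.symm_apply_eq]
    rfl
  simp [this]

theorem IsSES.exists_lift (hs : IsSES i p) (k : X' →ₗ[R] E) (hk : p ∘ₗ k = 0) :
    ∃ l : X' →ₗ[R] X, i ∘ₗ l = k := by
  have he : ∀ x, k x ∈ LinearMap.range i := fun x => (hs.exact _).1 (LinearMap.congr_fun hk x)
  exact ⟨(LinearEquiv.ofInjective i hs.inj).symm.toLinearMap ∘ₗ k.codRestrict _ he,
    LinearMap.ext fun x =>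
      congrArg Subtype.val ((LinearEquiv.ofInjective i hs.inj).apply_symm_apply ⟨k x, he x⟩)⟩

end Factor

/-! ### Test modules and the `Ext¹` groups they detect. -/

section Quad

variable {A B M N : Type u} [Ring A] [Ring B]
  [AddCommGroup M] [Module B M] [Module Aᵐᵒᵖ M] [SMulCommClass B Aᵐᵒᵖ M]
  [AddCommGroup N] [Module A N] [Module Bᵐᵒᵖ N] [SMulCommClass A Bᵐᵒᵖ N]
  {D : MoritaContext A B M N}
  {X Y X' Y' X'' V K C : Type u} [AddCommGroup X] [Module A X] [AddCommGroup Y] [Module B Y]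
  [AddCommGroup X'] [Module A X'] [AddCommGroup Y'] [Module B Y']
  [AddCommGroup X''] [Module A X''] [AddCommGroup V] [Module B V] [AddCommGroup K] [Module B K]
  [AddCommGroup C] [Module B C]

namespace MoritaContext

variable (D)

variable (X) in
/-- The data of the induced module `(X, M ⊗_A X)`. -/
def tensorQuad : D.Quad X (BalTensor A M X) := ⟨LinearMap.id, D.kappa X, fun _ => rfl⟩

variable (X) in
/-- The data of the coinduced module `(X, Hom_A(N, X))`. -/
def homQuad : D.Quad X (HomLeft A N X) := ⟨D.kappa X, LinearMap.id, fun _ => rfl⟩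

variable (V) in
/-- The data of the module `(0, V)`. -/
def botQuad : D.Quad PUnit.{u + 1} V := ⟨0, 0, fun _ => HomLeft.ext fun _ => rfl⟩

namespace Quad

variable {D} (s : D.Quad X Y)

/-- Change the second component along a map out of it. -/
def pushBot (v : Y →ₗ[B] Y') (k : Y' →ₗ[B] HomLeft A N X) (h : k ∘ₗ v = s.k) : D.Quad X Y' :=
  ⟨v ∘ₗ s.f, k, fun t => by rw [LinearMap.comp_apply, ← LinearMap.comp_apply k, h, s.k_f]⟩

/-- Change the second component along a map into it. -/
def pullBot (v : Y' →ₗ[B] Y) (f : BalTensor A M X →ₗ[B] Y') (h : v ∘ₗ f = s.f) : D.Quad X Y' :=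
  ⟨f, s.k ∘ₗ v, fun t => by rw [LinearMap.comp_apply, ← LinearMap.comp_apply v, h, s.k_f]⟩

variable [Subsingleton (BalTensor A M N)] {s} {t : D.Quad X' Y'}

/-- Extend `u : X → X'` to a homomorphism from `(X, M ⊗_A X)`. -/
def tensorHom (t : D.Quad X' Y') (u : X →ₗ[A] X') :
    (D.tensorQuad X).Carrier →ₗ[MoritaRing D] t.Carrier :=
  hom u (t.f ∘ₗ BalTensor.lTensor B M u) rfl <| LinearMap.ext fun z =>
    (t.k_f _).trans (D.kappa_natural_apply u z).symm

/-- Extend `u : X → X'` to a homomorphism to `(X', Hom_A(N, X'))`. -/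
def homHom (s : D.Quad X Y) (u : X →ₗ[A] X') :
    s.Carrier →ₗ[MoritaRing D] (D.homQuad X').Carrier :=
  hom u (HomLeft.postcomp B N u ∘ₗ s.k) (LinearMap.ext fun z =>
    (congrArg (HomLeft.postcomp B N u) (s.k_f z)).trans (D.kappa_natural_apply u z)) rfl

/-- The homomorphism from `(0, V)` given by `v : V → Y` with `k v = 0`. -/
def fromBot (v : V →ₗ[B] Y) (hv : s.k ∘ₗ v = 0) :
    (D.botQuad V).Carrier →ₗ[MoritaRing D] s.Carrier :=
  hom 0 v (BalTensor.linHom_ext fun m x => by simp [botQuad])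
    (by rw [hv]; exact LinearMap.ext fun _ => HomLeft.ext fun _ => rfl)

/-- The homomorphism to `(0, V)` given by `v : Y → V` with `v f = 0`. -/
def toBot (v : Y →ₗ[B] V) (hv : v ∘ₗ s.f = 0) :
    s.Carrier →ₗ[MoritaRing D] (D.botQuad V).Carrier :=
  hom 0 v (by rw [hv]; exact LinearMap.ext fun _ => rfl)
    (LinearMap.ext fun _ => HomLeft.ext fun _ => rfl)

@[simp] theorem topHom_tensorHom (u : X →ₗ[A] X') : topHom (tensorHom t u) = u := rfl
@[simp] theorem botHom_tensorHom (u : X →ₗ[A] X') :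
    botHom (tensorHom t u) = t.f ∘ₗ BalTensor.lTensor B M u := rfl
@[simp] theorem topHom_homHom (u : X →ₗ[A] X') : topHom (homHom s u) = u := rfl
@[simp] theorem botHom_homHom (u : X →ₗ[A] X') :
    botHom (homHom s u) = HomLeft.postcomp B N u ∘ₗ s.k := rfl
@[simp] theorem botHom_fromBot (v : V →ₗ[B] Y) (hv : s.k ∘ₗ v = 0) :
    botHom (fromBot v hv) = v := rfl
@[simp] theorem botHom_toBot (v : Y →ₗ[B] V) (hv : v ∘ₗ s.f = 0) : botHom (toBot v hv) = v := rfl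

/-- The structure map `f` of `(X, M ⊗ X)` is the identity, so compatibility with `f` expresses the
second component of a homomorphism through the first. -/
theorem tensorQuad_hom_ext {F G : (D.tensorQuad X).Carrier →ₗ[MoritaRing D] t.Carrier}
    (h : topHom F = topHom G) : F = G :=
  hom_ext h <| LinearMap.ext fun z =>
    (botHom_f_apply F z).trans ((by rw [h]) : _ = _) |>.trans (botHom_f_apply G z).symm

theorem homQuad_hom_ext {F G : s.Carrier →ₗ[MoritaRing D] (D.homQuad X').Carrier}
    (h : topHom F = topHom G) : F = G :=
  hom_ext h <| LinearMap.ext fun z =>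
    (k_botHom_apply F z).trans ((by rw [h]) : _ = _) |>.trans (k_botHom_apply G z).symm

theorem botQuad_hom_ext_left {F G : (D.botQuad V).Carrier →ₗ[MoritaRing D] t.Carrier}
    (h : botHom F = botHom G) : F = G :=
  hom_ext (LinearMap.ext fun x => by
    rw [Subsingleton.elim x 0, map_zero, map_zero]) h

theorem botQuad_hom_ext_right {F G : s.Carrier →ₗ[MoritaRing D] (D.botQuad V).Carrier}
    (h : botHom F = botHom G) : F = G :=
  hom_ext (LinearMap.ext fun _ => rfl) h

/-- By `equivQuadOf` the middle term of any extension may be taken to be of the form `e.Carrier`, so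
that the extension can be studied by components. -/
theorem extZero_of_section
    (h : ∀ {X₀ Y₀ : Type u} [AddCommGroup X₀] [Module A X₀] [AddCommGroup Y₀] [Module B Y₀]
      (e : D.Quad X₀ Y₀) (F : t.Carrier →ₗ[MoritaRing D] e.Carrier)
      (G : e.Carrier →ₗ[MoritaRing D] s.Carrier), IsSES F G → ∃ S, G ∘ₗ S = LinearMap.id) :
    ExtZero (MoritaRing D) s.Carrier t.Carrier := by
  refine .of_section fun E _ _ i p hs => ?_
  obtain ⟨S, hS⟩ := h (D.quadOf E) ((D.equivQuadOf E).symm.toLinearMap ∘ₗ i)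
    (p ∘ₗ (D.equivQuadOf E).toLinearMap)
    ⟨(D.equivQuadOf E).symm.injective.comp hs.inj, fun w => by
      rw [LinearMap.comp_apply]
      refine (hs.exact _).trans ⟨?_, ?_⟩
      · rintro ⟨x, hx⟩
        exact ⟨x, (D.equivQuadOf E).symm_apply_eq.2 hx⟩
      · rintro ⟨x, hx⟩
        exact ⟨x, (D.equivQuadOf E).symm_apply_eq.1 hx⟩,
      hs.surj.comp (D.equivQuadOf E).surjective⟩
  exact ⟨(D.equivQuadOf E).toLinearMap ∘ₗ S, hS⟩

theorem extZero_of_retraction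
    (h : ∀ {X₀ Y₀ : Type u} [AddCommGroup X₀] [Module A X₀] [AddCommGroup Y₀] [Module B Y₀]
      (e : D.Quad X₀ Y₀) (F : t.Carrier →ₗ[MoritaRing D] e.Carrier)
      (G : e.Carrier →ₗ[MoritaRing D] s.Carrier), IsSES F G → ∃ S, S ∘ₗ F = LinearMap.id) :
    ExtZero (MoritaRing D) s.Carrier t.Carrier := by
  refine extZero_of_section fun e F G hs => ?_
  obtain ⟨S, hS⟩ := h e F G hs
  have H := (hs.exact.split_tfae').out 0 1
  exact (H.2 ⟨hs.surj, S, hS⟩).2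

/-! ### Extensions of induced modules and extensions by coinduced modules -/

theorem isSES_tensorHom {i : X →ₗ[A] X'} {p : X' →ₗ[A] X''} (hs : IsSES i p)
    (h : TorOneVanishes A M (ModuleCat.of A X'')) :
    IsSES (tensorHom (D.tensorQuad X') i) (tensorHom (D.tensorQuad X'') p) :=
  isSES_iff.2 ⟨hs, BalTensor.isSES_lTensor h hs⟩

theorem isSES_homHom {i : X →ₗ[A] X'} {p : X' →ₗ[A] X''} (hs : IsSES i p)
    (h : ExtZero A N X) : IsSES (homHom (D.homQuad X) i) (homHom (D.homQuad X') p) :=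
  isSES_iff.2 ⟨hs, HomLeft.isSES_postcomp h hs⟩

/-- A section on first components exists because `Ext¹(X, X') = 0`; by the universal property of
`(X, M ⊗ X)` it extends to a section of modules. No Tor condition is needed in this direction. -/
theorem extZero_tensorQuad (h : ExtZero A X X') :
    ExtZero (MoritaRing D) (D.tensorQuad X).Carrier t.Carrier := by
  refine extZero_of_section fun e F G hs => ?_
  obtain ⟨l, hl⟩ := h.lift (isSES_iff.1 hs).1 LinearMap.id
  exact ⟨tensorHom e l, tensorQuad_hom_ext (by simpa using hl)⟩

/-- Vanishing of `Tor₁(M, X)` keeps a projective presentation `0 → K → P → X → 0` exact after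
passing to induced modules. A map `K → X'` induces one from `(K, M ⊗ K)`, which extends to `(P, M ⊗
P)`; its first component is the extension sought. -/
theorem extZero_of_extZero_tensorQuad (hT : TorOneVanishes A M (ModuleCat.of A X))
    (h : ExtZero (MoritaRing D) (D.tensorQuad X).Carrier t.Carrier) : ExtZero A X X' := by
  obtain ⟨K, P, _, _, _, _, i, p, hs, hP⟩ := exists_projective_presentation A X
  refine .of_extend hs .of_projective fun k => ?_
  obtain ⟨L, hL⟩ := h.extend (isSES_tensorHom hs hT) (tensorHom t k)
  exact ⟨topHom L, by simpa using congrArg topHom hL⟩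

theorem extZero_homQuad (h : ExtZero A X X') :
    ExtZero (MoritaRing D) s.Carrier (D.homQuad X').Carrier := by
  refine extZero_of_retraction fun e F G hs => ?_
  obtain ⟨l, hl⟩ := h.extend (isSES_iff.1 hs).1 LinearMap.id
  exact ⟨homHom e l, homQuad_hom_ext (by simpa using hl)⟩

/-- Dual to the induced case: `Ext¹(N, X') = 0` keeps an injective copresentation of `X'` exact
after passing to coinduced modules. -/
theorem extZero_of_extZero_homQuad (hN : ExtZero A N X')
    (h : ExtZero (MoritaRing D) s.Carrier (D.homQuad X').Carrier) : ExtZero A X X' := by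
  obtain ⟨I, K, _, _, _, _, i, p, hs, hI⟩ := exists_injective_copresentation A X'
  refine .of_lift hs .of_injective fun k => ?_
  obtain ⟨L, hL⟩ := h.lift (isSES_homHom hs hN) (homHom s k)
  exact ⟨topHom L, by simpa using congrArg topHom hL⟩

/-! ### Extensions of and by modules concentrated in the second component -/

theorem isSES_botQuad {i : K →ₗ[B] Y} {p : Y →ₗ[B] C} (hs : IsSES i p) :
    IsSES (fromBot (D := D) (s := D.botQuad Y) i (LinearMap.ext fun _ => rfl))
      (toBot (D := D) (s := D.botQuad Y) p (LinearMap.ext fun _ => map_zero p)) :=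
  isSES_iff.2 ⟨⟨fun _ _ _ => rfl, fun _ => ⟨fun _ => ⟨0, rfl⟩, fun _ => rfl⟩, fun _ => ⟨0, rfl⟩⟩, hs⟩

/-- A way to manufacture test extensions of `(0, C)` by a given module, with the first component
unchanged. -/
theorem isSES_pushBot {v : Y →ₗ[B] Y'} {q : Y' →ₗ[B] C} (hs : IsSES v q)
    {k : Y' →ₗ[B] HomLeft A N X} (h : k ∘ₗ v = s.k) :
    IsSES (hom LinearMap.id v (by rw [BalTensor.lTensor_id]; rfl) h :
        s.Carrier →ₗ[MoritaRing D] (s.pushBot v k h).Carrier)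
      (toBot q (LinearMap.ext fun _ => hs.exact.apply_apply_eq_zero _)) :=
  isSES_iff.2 ⟨⟨fun _ _ e => e, fun x => ⟨fun _ => ⟨x, rfl⟩, fun _ => rfl⟩, fun _ => ⟨0, rfl⟩⟩, hs⟩

theorem isSES_pullBot {j : K →ₗ[B] Y'} {v : Y' →ₗ[B] Y} (hs : IsSES j v)
    {f : BalTensor A M X →ₗ[B] Y'} (h : v ∘ₗ f = s.f) :
    IsSES (fromBot j (LinearMap.ext fun y =>
        (congrArg s.k (hs.exact.apply_apply_eq_zero y)).trans (map_zero s.k)))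
      (hom LinearMap.id v (by rw [BalTensor.lTensor_id]; exact h) rfl :
        (s.pullBot v f h).Carrier →ₗ[MoritaRing D] s.Carrier) :=
  isSES_iff.2 ⟨⟨fun _ _ _ => rfl, fun _ => ⟨fun e => ⟨0, e.symm⟩, fun ⟨_, e⟩ => e.symm⟩,
    fun x => ⟨x, rfl⟩⟩, hs⟩

/-- In an extension `e` of `(0, V)` by `s`, first components are identified by `topHom F`. As `s.k`
is onto, kernels of the maps `k` give an exact sequence `0 → K → Ker e.k → V → 0`; a section of it
is a homomorphism out of `(0, V)`. -/
theorem extZero_botQuad_left {j : K →ₗ[B] Y} (hs : IsSES j s.k) (h : ExtZero B V K) :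
    ExtZero (MoritaRing D) (D.botQuad V).Carrier s.Carrier := by
  refine extZero_of_section fun e F G hFG => ?_
  obtain ⟨h₁, h₂⟩ := isSES_iff.1 hFG
  have hF : Function.Surjective (topHom F) := fun x => (h₁.exact x).1 rfl
  let E := LinearEquiv.ofBijective (topHom F) ⟨h₁.inj, hF⟩
  let a : K →ₗ[B] LinearMap.ker e.k := (botHom F ∘ₗ j).codRestrict _ fun y => by
    rw [LinearMap.mem_ker, LinearMap.comp_apply, k_botHom_apply, hs.exact.apply_apply_eq_zero,
      map_zero]
  let b : LinearMap.ker e.k →ₗ[B] V := botHom G ∘ₗ (LinearMap.ker e.k).subtype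
  have hab : IsSES a b := by
    refine ⟨fun x y e => ?_, fun z => ⟨fun hz => ?_, ?_⟩, fun v => ?_⟩
    · exact hs.inj (h₂.inj (congrArg Subtype.val e))
    · obtain ⟨y, hy⟩ := (h₂.exact z).1 hz
      obtain ⟨x, hx⟩ := (hs.exact y).1 (by
        have := k_botHom_apply F y
        rw [hy, z.2] at this
        ext n
        exact h₁.inj ((DFunLike.congr_fun this n).symm.trans (map_zero (topHom F)).symm))
      exact ⟨x, Subtype.ext (by rw [← hy, ← hx]; rfl)⟩
    · rintro ⟨x, rfl⟩
      exact h₂.exact.apply_apply_eq_zero _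
    · obtain ⟨z, rfl⟩ := h₂.surj v
      -- An arbitrary preimage `z` is corrected into `Ker e.k` by an element of `Y` with the same
      -- image under `k`; this is where surjectivity of `s.k` enters.
      obtain ⟨y, hy⟩ := hs.surj (HomLeft.postcomp B N E.symm.toLinearMap (e.k z))
      refine ⟨⟨z - botHom F y, ?_⟩, ?_⟩
      · rw [LinearMap.mem_ker, map_sub, k_botHom_apply, hy, sub_eq_zero]
        ext n
        exact (E.apply_symm_apply _).symm
      · change botHom G (z - botHom F y) = _
        rw [map_sub, h₂.exact.apply_apply_eq_zero, sub_zero]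
  obtain ⟨l, hl⟩ := h.lift hab LinearMap.id
  exact ⟨fromBot ((LinearMap.ker e.k).subtype ∘ₗ l) (LinearMap.ext fun v => (l v).2),
    botQuad_hom_ext_right ((botHom_comp _ _).trans hl)⟩

/-- Homomorphisms from `(0, P)` to `s` are the same as maps `P → K`, so extending along a projective
presentation of `V` can be done among Morita modules. -/
theorem extZero_of_extZero_botQuad_left {j : K →ₗ[B] Y} (hs : IsSES j s.k)
    (h : ExtZero (MoritaRing D) (D.botQuad V).Carrier s.Carrier) : ExtZero B V K := by
  obtain ⟨K₀, P, _, _, _, _, i, p, hip, hP⟩ := exists_projective_presentation B V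
  refine .of_extend hip .of_projective fun k => ?_
  obtain ⟨L, hL⟩ := h.extend (isSES_botQuad hip) (fromBot (j ∘ₗ k)
    (by rw [← LinearMap.comp_assoc, hs.exact.linearMap_comp_eq_zero, LinearMap.zero_comp]))
  obtain ⟨l, hl⟩ := hs.exists_lift (botHom L)
    ((k_botHom L).trans
      (LinearMap.ext fun _ => map_zero (HomLeft.postcomp B N (topHom L))))
  refine ⟨l, LinearMap.ext fun x => hs.inj ?_⟩
  have h1 := LinearMap.congr_fun hl (i x)
  have h2 := LinearMap.congr_fun (congrArg botHom hL) x
  rw [botHom_comp] at h2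
  exact h1.trans h2

/-- For `g` in `Hom_A(N, X)`, enlarge `Y` to `Y × B` and extend `k` by `1 ↦ g`. This is an extension
of `(0, B)`; a section sends `1` to some `(y, 1)` killed by the new `k`, as its source has zero
first component. Hence `k y + g = 0`. -/
theorem k_surjective (h : ExtZero (MoritaRing D) (D.botQuad B).Carrier s.Carrier) :
    Function.Surjective s.k := by
  intro g
  have hs : IsSES (LinearMap.inl B Y B) (LinearMap.snd B Y B) :=
    ⟨LinearMap.inl_injective, Function.Exact.inl_snd, LinearMap.snd_surjective⟩
  obtain ⟨S, hS⟩ := h.lift (isSES_pushBot hs (k := s.k.coprod (LinearMap.toSpanSingleton B _ g))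
    (LinearMap.coprod_inl _ _)) LinearMap.id
  have h1 : ((botHom S) (1 : B)).2 = 1 := LinearMap.congr_fun (congrArg botHom hS) (1 : B)
  have h2 := k_botHom_apply S (1 : B)
  replace h2 : s.k ((botHom S) (1 : B)).1 + ((botHom S) (1 : B)).2 • g = 0 :=
    h2.trans (map_zero (HomLeft.postcomp B N (topHom S)))
  rw [h1, one_smul] at h2
  exact ⟨-((botHom S) (1 : B)).1, (map_neg _ _).trans (eq_neg_of_add_eq_zero_right h2).symm⟩

/-- Dual argument: in an extension of `s` by `(0, V)` first components are identified by `topHom G`,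
and injectivity of `s.f` makes `0 → V → Coker e.f → C → 0` exact. A retraction of it gives a
homomorphism to `(0, V)`. -/
theorem extZero_botQuad_right {q : Y →ₗ[B] C} (hs : IsSES s.f q) (h : ExtZero B C V) :
    ExtZero (MoritaRing D) s.Carrier (D.botQuad V).Carrier := by
  refine extZero_of_retraction fun e F G hFG => ?_
  obtain ⟨h₁, h₂⟩ := isSES_iff.1 hFG
  have hG : Function.Injective (topHom G) := by
    rw [injective_iff_map_eq_zero]
    intro x hx
    obtain ⟨y, rfl⟩ := (h₁.exact x).1 hx
    rw [Subsingleton.elim y 0, map_zero]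
  let E := LinearEquiv.ofBijective (topHom G) ⟨hG, h₁.surj⟩
  have hE : ∀ z, BalTensor.lTensor B M E.symm.toLinearMap
      (BalTensor.lTensor B M (topHom G) z) = z := fun z => by
    rw [← LinearMap.comp_apply, ← BalTensor.lTensor_comp]
    have : E.symm.toLinearMap ∘ₗ topHom G = LinearMap.id :=
      LinearMap.ext fun x => E.symm_apply_apply x
    rw [this, BalTensor.lTensor_id, LinearMap.id_apply]
  have hE' : ∀ z, BalTensor.lTensor B M (topHom G)
      (BalTensor.lTensor B M E.symm.toLinearMap z) = z := fun z => by
    rw [← LinearMap.comp_apply, ← BalTensor.lTensor_comp]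
    have : topHom G ∘ₗ E.symm.toLinearMap = LinearMap.id :=
      LinearMap.ext fun x => E.apply_symm_apply x
    rw [this, BalTensor.lTensor_id, LinearMap.id_apply]
  let T := LinearMap.range e.f
  let a : V →ₗ[B] _ ⧸ T := T.mkQ ∘ₗ botHom F
  let b : _ ⧸ T →ₗ[B] C := T.liftQ (q ∘ₗ botHom G) (by
    rintro _ ⟨z, rfl⟩
    rw [LinearMap.mem_ker, LinearMap.comp_apply, botHom_f_apply, hs.exact.apply_apply_eq_zero])
  have hab : IsSES a b := by
    refine ⟨?_, fun c => ?_, fun c => ?_⟩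
    · rw [injective_iff_map_eq_zero]
      intro v hv
      obtain ⟨z, hz⟩ := (Submodule.Quotient.mk_eq_zero T).1 hv
      have h0 := congrArg (botHom G) hz
      rw [h₂.exact.apply_apply_eq_zero, botHom_f_apply] at h0
      have h0' := hs.inj (h0.trans (map_zero s.f).symm)
      have hz0 : z = 0 := by rw [← hE z, h0', map_zero]
      rw [hz0, map_zero] at hz
      exact h₂.inj (hz.symm.trans (map_zero _).symm)
    · obtain ⟨y, rfl⟩ := T.mkQ_surjective c
      constructor
      · intro hy
        obtain ⟨z, hz⟩ := (hs.exact (botHom G y)).1 hy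
        obtain ⟨v, hv⟩ := (h₂.exact (y - e.f (BalTensor.lTensor B M E.symm.toLinearMap z))).1 (by
          rw [map_sub, botHom_f_apply, hE', hz, sub_self])
        refine ⟨v, (Submodule.Quotient.eq T).2 ?_⟩
        rw [hv, sub_sub_cancel_left]
        exact neg_mem ⟨_, rfl⟩
      · rintro ⟨v, hv⟩
        rw [← hv]
        change q (botHom G (botHom F v)) = 0
        rw [h₂.exact.apply_apply_eq_zero, map_zero]
    · obtain ⟨y, rfl⟩ := hs.surj c
      obtain ⟨y, rfl⟩ := h₂.surj y
      exact ⟨T.mkQ y, rfl⟩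
  obtain ⟨l, hl⟩ := h.extend hab LinearMap.id
  have hT : ∀ z, T.mkQ (e.f z) = 0 := fun z => (Submodule.Quotient.mk_eq_zero T).2 ⟨z, rfl⟩
  refine ⟨toBot (l ∘ₗ T.mkQ) (LinearMap.ext fun z => by simp [hT]), botQuad_hom_ext_left ((botHom_comp _ _).trans hl)⟩

theorem extZero_of_extZero_botQuad_right {q : Y →ₗ[B] C} (hs : IsSES s.f q)
    (h : ExtZero (MoritaRing D) s.Carrier (D.botQuad V).Carrier) : ExtZero B C V := by
  obtain ⟨I, K₀, _, _, _, _, i, p, hip, hI⟩ := exists_injective_copresentation B V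
  refine .of_lift hip .of_injective fun k => ?_
  obtain ⟨L, hL⟩ := h.lift (isSES_botQuad hip) (toBot (k ∘ₗ q)
    (by rw [LinearMap.comp_assoc, hs.exact.linearMap_comp_eq_zero, LinearMap.comp_zero]))
  obtain ⟨l, hl⟩ := hs.exists_desc (botHom L) ((botHom_f L).trans (LinearMap.ext fun _ => rfl))
  refine ⟨l, LinearMap.ext fun c => ?_⟩
  obtain ⟨y, rfl⟩ := hs.surj c
  have h1 := LinearMap.congr_fun hl y
  have h2 := LinearMap.congr_fun (congrArg botHom hL) y
  rw [botHom_comp] at h2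
  exact (congrArg p h1).trans h2

/-- Enlarge `Y` to `V × Y` with structure map `(h, f)`. A section of this extension is the identity
on first components, so it carries `f z` to `(h z, f z)`; thus `f z = 0` forces `h z = 0`. -/
theorem f_injective {h : BalTensor A M X →ₗ[B] V} (hh : Function.Injective h)
    (hV : ExtZero (MoritaRing D) s.Carrier (D.botQuad V).Carrier) : Function.Injective s.f := by
  have hs : IsSES (LinearMap.inl B V Y) (LinearMap.snd B V Y) :=
    ⟨LinearMap.inl_injective, Function.Exact.inl_snd, LinearMap.snd_surjective⟩
  obtain ⟨S, hS⟩ := hV.lift (isSES_pullBot hs (f := h.prod s.f) (LinearMap.snd_prod _ _))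
    LinearMap.id
  have h1 : topHom S = LinearMap.id := congrArg topHom hS
  rw [injective_iff_map_eq_zero]
  intro z hz
  have h2 := botHom_f_apply S z
  rw [hz, map_zero, h1, BalTensor.lTensor_id] at h2
  exact hh ((congrArg Prod.fst h2).symm.trans (map_zero h).symm)

end Quad

end MoritaContext

end Quad

/-! ### Pullbacks of short exact sequences and pieces of the snake lemma. -/

section ShortExact

variable {R : Type u} [Ring R] {C E X C' E' X' X'' E'' : Type u}
  [AddCommGroup C] [Module R C] [AddCommGroup E] [Module R E] [AddCommGroup X] [Module R X]
  [AddCommGroup C'] [Module R C'] [AddCommGroup E'] [Module R E'] [AddCommGroup X'] [Module R X']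
  [AddCommGroup X''] [Module R X''] [AddCommGroup E''] [Module R E'']

/-- The submodule `{(e, c) | p e = k c}` of `E × C'`. -/
abbrev LinearMap.pullback (p : E →ₗ[R] C) (k : C' →ₗ[R] C) : Submodule R (E × C') :=
  LinearMap.eqLocus (p ∘ₗ LinearMap.fst R E C') (k ∘ₗ LinearMap.snd R E C')

namespace LinearMap

variable (p : E →ₗ[R] C) (k : C' →ₗ[R] C)

/-- The first projection of a pullback. -/
abbrev pullbackFst : pullback p k →ₗ[R] E := LinearMap.fst R E C' ∘ₗ (pullback p k).subtype

/-- The second projection of a pullback. -/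
abbrev pullbackSnd : pullback p k →ₗ[R] C' := LinearMap.snd R E C' ∘ₗ (pullback p k).subtype

variable {p k}

/-- The map to a pullback given by its components. -/
abbrev pullbackLift (a : X →ₗ[R] E) (b : X →ₗ[R] C') (h : p ∘ₗ a = k ∘ₗ b) :
    X →ₗ[R] pullback p k :=
  (a.prod b).codRestrict _ fun x => LinearMap.congr_fun h x

end LinearMap

namespace IsSES

open LinearMap

variable {i : X →ₗ[R] E} {p : E →ₗ[R] C}

theorem pullback_snd (hs : IsSES i p) (k : C' →ₗ[R] C) :
    IsSES (pullbackLift (k := k) i 0 (by rw [hs.exact.linearMap_comp_eq_zero, comp_zero]))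
      (pullbackSnd p k) where
  inj _ _ e := hs.inj (congrArg (fun z : pullback p k => z.1.1) e)
  exact z := by
    refine ⟨fun hz => ?_, ?_⟩
    · obtain ⟨x, hx⟩ := (hs.exact z.1.1).1
        ((z.2 : p z.1.1 = k z.1.2).trans ((congrArg k hz).trans (map_zero k)))
      exact ⟨x, Subtype.ext (Prod.ext hx hz.symm)⟩
    · rintro ⟨x, rfl⟩
      rfl
  surj c := by
    obtain ⟨e, he⟩ := hs.surj (k c)
    exact ⟨⟨(e, c), he⟩, rfl⟩

theorem pullback_fst (hs : IsSES i p) (k : C' →ₗ[R] C) :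
    IsSES (pullbackLift (p := k) 0 i (by rw [hs.exact.linearMap_comp_eq_zero, comp_zero]))
      (pullbackFst k p) where
  inj _ _ e := hs.inj (congrArg (fun z : pullback k p => z.1.2) e)
  exact z := by
    refine ⟨fun hz => ?_, ?_⟩
    · obtain ⟨x, hx⟩ := (hs.exact z.1.2).1
        ((z.2 : k z.1.1 = p z.1.2).symm.trans ((congrArg k hz).trans (map_zero k)))
      exact ⟨x, Subtype.ext (Prod.ext hz.symm hx)⟩
    · rintro ⟨x, rfl⟩
      rfl
  surj c := by
    obtain ⟨e, he⟩ := hs.surj (k c)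
    exact ⟨⟨(c, e), he.symm⟩, rfl⟩

/-- The kernel of a composition of epimorphisms is an extension of their kernels. -/
theorem exists_comp (hs : IsSES i p) {j : X' →ₗ[R] C} {q : C →ₗ[R] C'} (ht : IsSES j q) :
    ∃ (K : Type u) (_ : AddCommGroup K) (_ : Module R K) (a : X →ₗ[R] K) (b : K →ₗ[R] X')
      (c : K →ₗ[R] E), IsSES a b ∧ IsSES c (q ∘ₗ p) := by
  refine ⟨pullback p j, _, _, _, _, pullbackFst p j, hs.pullback_snd j, fun y z e => ?_,
    fun y => ⟨fun hy => ?_, ?_⟩, ht.surj.comp hs.surj⟩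
  · refine Subtype.ext (Prod.ext e (ht.inj ?_))
    exact (y.2.symm.trans (congrArg p e)).trans z.2
  · obtain ⟨x, hx⟩ := (ht.exact (p y)).1 hy
    exact ⟨⟨(y, x), hx.symm⟩, rfl⟩
  · rintro ⟨z, rfl⟩
    change q (p z.1.1) = 0
    rw [show p z.1.1 = j z.1.2 from z.2, ht.exact.apply_apply_eq_zero]

/-- The cokernel of the first map of a short exact sequence. -/
noncomputable def quotEquiv (hs : IsSES i p) : (E ⧸ LinearMap.range i) ≃ₗ[R] C :=
  (Submodule.quotEquivOfEq _ _ (LinearMap.exact_iff.1 hs.exact).symm).trans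
    (p.quotKerEquivOfSurjective hs.surj)

/-- The kernel of the second map of a short exact sequence. -/
noncomputable def kerEquiv (hs : IsSES i p) : X ≃ₗ[R] LinearMap.ker p :=
  (LinearEquiv.ofInjective i hs.inj).trans
    (LinearEquiv.ofEq _ _ (LinearMap.exact_iff.1 hs.exact).symm)

theorem conj (hs : IsSES i p) (eX : X ≃ₗ[R] X') (eE : E ≃ₗ[R] E') (eC : C ≃ₗ[R] C') :
    IsSES (eE.toLinearMap ∘ₗ i ∘ₗ eX.symm.toLinearMap)
      (eC.toLinearMap ∘ₗ p ∘ₗ eE.symm.toLinearMap) := by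
  refine ⟨eE.injective.comp (hs.inj.comp eX.symm.injective), fun z => ?_,
    eC.surjective.comp (hs.surj.comp eE.symm.surjective)⟩
  change eC (p (eE.symm z)) = 0 ↔ _
  rw [LinearEquiv.map_eq_zero_iff, hs.exact]
  constructor
  · rintro ⟨x, hx⟩
    exact ⟨eX x, by simp [hx]⟩
  · rintro ⟨x, hx⟩
    exact ⟨eX.symm x, by rw [← hx]; simp⟩

theorem comp_equiv (hs : IsSES i p) (e : C ≃ₗ[R] C') : IsSES i (e.toLinearMap ∘ₗ p) :=
  ⟨hs.inj, fun z => e.map_eq_zero_iff.trans (hs.exact z), e.surjective.comp hs.surj⟩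

variable {i' : X' →ₗ[R] E'} {p' : E' →ₗ[R] C'}
  {a : X →ₗ[R] X'} {b : E →ₗ[R] E'} {c : C →ₗ[R] C'}

/-- Snake lemma: the connecting map into the cokernel of `a` starts at `ker c = 0`. -/
theorem cokernels (hs : IsSES i p) (ht : IsSES i' p') (h₁ : b ∘ₗ i = i' ∘ₗ a)
    (h₂ : c ∘ₗ p = p' ∘ₗ b) (hc : Function.Injective c) :
    IsSES ((range a).mapQ (range b) i' (by rintro _ ⟨x, rfl⟩; exact ⟨i x, LinearMap.congr_fun h₁ x⟩))
      ((range b).mapQ (range c) p'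
        (by rintro _ ⟨x, rfl⟩; exact ⟨p x, LinearMap.congr_fun h₂ x⟩)) := by
  refine ⟨?_, fun z => ?_, fun z => ?_⟩
  · rw [injective_iff_map_eq_zero]
    intro z hz
    obtain ⟨y, rfl⟩ := (range a).mkQ_surjective z
    obtain ⟨e, he⟩ := (Submodule.Quotient.mk_eq_zero (range b)).1 hz
    obtain ⟨x, rfl⟩ := (hs.exact e).1 (hc (by
      rw [← LinearMap.comp_apply, h₂, LinearMap.comp_apply, he, ht.exact.apply_apply_eq_zero,
        map_zero]))
    exact (Submodule.Quotient.mk_eq_zero (range a)).2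
      ⟨x, ht.inj ((LinearMap.congr_fun h₁ x).symm.trans he)⟩
  · obtain ⟨y, rfl⟩ := (range b).mkQ_surjective z
    constructor
    · intro hz
      obtain ⟨d, hd⟩ := (Submodule.Quotient.mk_eq_zero (range c)).1 hz
      obtain ⟨e, rfl⟩ := hs.surj d
      obtain ⟨x, hx⟩ := (ht.exact (y - b e)).1 (by
        rw [map_sub, ← hd, sub_eq_zero]
        exact LinearMap.congr_fun h₂ e)
      refine ⟨(range a).mkQ x, (Submodule.Quotient.eq (range b)).2 ?_⟩
      rw [hx, sub_sub_cancel_left]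
      exact neg_mem ⟨e, rfl⟩
    · rintro ⟨w, hw⟩
      obtain ⟨x, rfl⟩ := (range a).mkQ_surjective w
      rw [← hw]
      change (range c).mkQ (p' (i' x)) = 0
      rw [ht.exact.apply_apply_eq_zero, map_zero]
  · obtain ⟨y, rfl⟩ := (range c).mkQ_surjective z
    obtain ⟨x, rfl⟩ := ht.surj y
    exact ⟨(range b).mkQ x, rfl⟩

/-- Snake lemma: the connecting map out of the kernel of `c` ends in the cokernel of `a`, which is
zero. -/
theorem kernels (hs : IsSES i p) (ht : IsSES i' p') (h₁ : b ∘ₗ i = i' ∘ₗ a)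
    (h₂ : c ∘ₗ p = p' ∘ₗ b) (ha : Function.Surjective a) :
    IsSES (i.restrict (p := ker a) (q := ker b) fun x hx =>
        (LinearMap.congr_fun h₁ x).trans ((congrArg i' hx).trans (map_zero i')))
      (p.restrict (p := ker b) (q := ker c) fun x hx =>
        (LinearMap.congr_fun h₂ x).trans ((congrArg p' hx).trans (map_zero p'))) := by
  refine ⟨fun x y e => Subtype.ext (hs.inj (congrArg Subtype.val e)), fun z => ⟨fun hz => ?_, ?_⟩,
    fun z => ?_⟩
  · obtain ⟨x, hx⟩ := (hs.exact z).1 (congrArg Subtype.val hz)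
    refine ⟨⟨x, ht.inj ?_⟩, Subtype.ext hx⟩
    rw [map_zero]
    exact (LinearMap.congr_fun h₁ x).symm.trans ((congrArg b hx).trans z.2)
  · rintro ⟨x, rfl⟩
    exact Subtype.ext (hs.exact.apply_apply_eq_zero _)
  · obtain ⟨y, hy⟩ := hs.surj z
    obtain ⟨x', hx'⟩ := (ht.exact (b y)).1 ((LinearMap.congr_fun h₂ y).symm.trans
      ((congrArg c hy).trans z.2))
    obtain ⟨x, rfl⟩ := ha x'
    refine ⟨⟨y - i x, ?_⟩, Subtype.ext ?_⟩
    · rw [mem_ker, map_sub, ← hx', sub_eq_zero]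
      exact (LinearMap.congr_fun h₁ x).symm
    · change p (y - i x) = z
      rw [map_sub, hs.exact.apply_apply_eq_zero, sub_zero, hy]

end IsSES

end ShortExact

/-! ### Closure properties of cotorsion pairs and Salce's lemma. -/

section CotorsionPairs

variable {R : Type u} [Ring R] {𝒞 𝒟 : ObjectProperty (ModuleCat.{u} R)}

namespace IsCotorsionPair

variable (h : IsCotorsionPair 𝒞 𝒟)
include h

theorem mem_left {X : ModuleCat.{u} R} : 𝒞 X ↔ ∀ Y, 𝒟 Y → ExtZero R X Y :=
  (congrFun h.2 X).symm.to_iff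

theorem mem_right {X : ModuleCat.{u} R} : 𝒟 X ↔ ∀ Y, 𝒞 Y → ExtZero R Y X :=
  (congrFun h.1 X).symm.to_iff

theorem extZero {X Y : ModuleCat.{u} R} (hX : 𝒞 X) (hY : 𝒟 Y) : ExtZero R X Y :=
  h.mem_left.1 hX Y hY

variable {X Y Z : Type u} [AddCommGroup X] [Module R X] [AddCommGroup Y] [Module R Y]
  [AddCommGroup Z] [Module R Z]

theorem congr_left (e : X ≃ₗ[R] Y) (hX : 𝒞 (ModuleCat.of R X)) : 𝒞 (ModuleCat.of R Y) :=
  h.mem_left.2 fun _ hZ => (h.extZero hX hZ).congr_left e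

theorem congr_right (e : X ≃ₗ[R] Y) (hX : 𝒟 (ModuleCat.of R X)) : 𝒟 (ModuleCat.of R Y) :=
  h.mem_right.2 fun _ hZ => (h.extZero hZ hX).congr_right e

theorem of_projective [Module.Projective R X] : 𝒞 (ModuleCat.of R X) :=
  h.mem_left.2 fun _ _ => .of_projective

theorem of_injective [Module.Injective R X] : 𝒟 (ModuleCat.of R X) :=
  h.mem_right.2 fun _ _ => .of_injective

theorem of_subsingleton_left [Subsingleton X] : 𝒞 (ModuleCat.of R X) := h.of_projective

theorem of_subsingleton_right [Subsingleton X] : 𝒟 (ModuleCat.of R X) :=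
  h.mem_right.2 fun _ _ => .of_retraction fun _ _ _ _ _ _ => ⟨0, Subsingleton.elim _ _⟩

theorem middle_right {i : X →ₗ[R] Y} {p : Y →ₗ[R] Z} (hs : IsSES i p)
    (hX : 𝒟 (ModuleCat.of R X)) (hZ : 𝒟 (ModuleCat.of R Z)) : 𝒟 (ModuleCat.of R Y) :=
  h.mem_right.2 fun _ hW => .middle_right hs (h.extZero hW hX) (h.extZero hW hZ)

/-- Salce's lemma: special precovers suffice for completeness. -/
theorem isCompletePair_of_precovers
    (hp : ∀ (Z : Type u) [AddCommGroup Z] [Module R Z], ∃ (K C : Type u) (_ : AddCommGroup K)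
      (_ : Module R K) (_ : AddCommGroup C) (_ : Module R C) (i : K →ₗ[R] C) (p : C →ₗ[R] Z),
      IsSES i p ∧ 𝒞 (ModuleCat.of R C) ∧ 𝒟 (ModuleCat.of R K)) : IsCompletePair 𝒞 𝒟 := by
  intro Z
  constructor
  · obtain ⟨K, C, _, _, _, _, i, p, hs, hC, hK⟩ := hp Z
    exact ⟨_, _, _, _, _, hs.shortExact, hC, hK⟩
  -- With `0 → Z → I → L → 0`, `I` injective, and a special precover `C → L` with kernel `K`, the
  -- pullback of `I` and `C` over `L` is an extension of `C` by `Z` and also of `I` by `K`; the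
  -- latter puts it in `𝒟`.
  · obtain ⟨I, L, _, _, _, _, j, q, hjq, hI⟩ := exists_injective_copresentation R Z
    obtain ⟨K, C, _, _, _, _, i, p, hs, hC, hK⟩ := hp L
    exact ⟨_, _, _, _, _, (hjq.pullback_snd p).shortExact, hC,
      h.middle_right (hs.pullback_fst q) hK h.of_injective⟩

end IsCotorsionPair

theorem IsCompletePair.exists_precover (h : IsCompletePair 𝒞 𝒟) (Z : Type u) [AddCommGroup Z]
    [Module R Z] : ∃ (K C : Type u) (_ : AddCommGroup K)
      (_ : Module R K) (_ : AddCommGroup C) (_ : Module R C) (i : K →ₗ[R] C) (p : C →ₗ[R] Z),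
      IsSES i p ∧ 𝒞 (ModuleCat.of R C) ∧ 𝒟 (ModuleCat.of R K) := by
  obtain ⟨⟨K, C, i, p, w, hs, hC, hK⟩, -⟩ := h (ModuleCat.of R Z)
  exact ⟨K, C, _, _, _, _, i.hom, p.hom, (ModuleCat.shortExact_iff_isSES _).1 hs, hC, hK⟩

end CotorsionPairs

/-! ### The cotorsion pairs over the Morita ring when `M ⊗_A N = 0`. -/

section MoritaCotorsion

variable {A B M N : Type u} [Ring A] [Ring B]
  [AddCommGroup M] [Module B M] [Module Aᵐᵒᵖ M] [SMulCommClass B Aᵐᵒᵖ M]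
  [AddCommGroup N] [Module A N] [Module Bᵐᵒᵖ N] [SMulCommClass A Bᵐᵒᵖ N]
  {D : MoritaContext A B M N}
  {𝒰 𝒳 : ObjectProperty (ModuleCat.{u} A)} {𝒱 𝒴 : ObjectProperty (ModuleCat.{u} B)}
  {X Y X' K C : Type u} [AddCommGroup X] [Module A X] [AddCommGroup Y] [Module B Y]
  [AddCommGroup X'] [Module A X'] [AddCommGroup K] [Module B K] [AddCommGroup C] [Module B C]

namespace MoritaContext

open Quad

theorem isSES_id_zero : IsSES (LinearMap.id : Y →ₗ[B] Y) (0 : Y →ₗ[B] PUnit.{u + 1}) :=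
  ⟨fun _ _ h => h, fun y => ⟨fun _ => ⟨y, rfl⟩, fun _ => rfl⟩, fun _ => ⟨0, rfl⟩⟩

theorem isSES_zero_id : IsSES (0 : PUnit.{u + 1} →ₗ[B] Y) LinearMap.id :=
  ⟨fun _ _ _ => rfl, fun _ => ⟨fun h => ⟨0, h.symm⟩, fun ⟨_, h⟩ => h.symm⟩, fun y => ⟨y, rfl⟩⟩

instance : Subsingleton (BalTensor A M PUnit.{u + 1}) :=
  subsingleton_of_forall_eq 0 fun t => by
    induction t using BalTensor.induction_on with
    | zero => rfl
    | tmul m x => exact BalTensor.tmul_zero m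
    | add s t hs ht => rw [hs, ht, add_zero]

instance : Subsingleton (HomLeft A N PUnit.{u + 1}) := ⟨fun _ _ => HomLeft.ext fun _ => rfl⟩

variable (D) in
theorem isSES_botQuad_f : IsSES (D.botQuad Y).f (LinearMap.id : Y →ₗ[B] Y) :=
  ⟨fun _ _ _ => Subsingleton.elim _ _, fun _ => ⟨fun h => ⟨0, h.symm⟩, fun ⟨_, h⟩ => h.symm⟩,
    fun y => ⟨y, rfl⟩⟩

variable (D) in
theorem isSES_botQuad_k : IsSES (LinearMap.id : Y →ₗ[B] Y) (D.botQuad Y).k :=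
  ⟨fun _ _ h => h, fun y => ⟨fun _ => ⟨y, rfl⟩, fun _ => rfl⟩, fun _ => ⟨0, Subsingleton.elim _ _⟩⟩

variable [Subsingleton (BalTensor A M N)]

theorem classM₁_of_isSES (hU : IsCotorsionPair 𝒰 𝒳) (hV : IsCotorsionPair 𝒱 𝒴) {s : D.Quad X Y}
    {q : Y →ₗ[B] C} (hs : IsSES s.f q) (hC : 𝒱 (ModuleCat.of B C)) (hX : 𝒰 (ModuleCat.of A X)) :
    D.classM₁ 𝒰 𝒱 (ModuleCat.of _ s.Carrier) := by
  have hc : ∀ z, BalTensor.lTensor B M s.topEquiv.symm.toLinearMap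
      (BalTensor.lTensor B M s.topEquiv.toLinearMap z) = z := fun z => by
    rw [← LinearMap.comp_apply, ← BalTensor.lTensor_comp, LinearEquiv.symm_comp,
      BalTensor.lTensor_id, LinearMap.id_apply]
  have hc' : ∀ z, BalTensor.lTensor B M s.topEquiv.toLinearMap
      (BalTensor.lTensor B M s.topEquiv.symm.toLinearMap z) = z := fun z => by
    rw [← LinearMap.comp_apply, ← BalTensor.lTensor_comp, LinearEquiv.comp_symm,
      BalTensor.lTensor_id, LinearMap.id_apply]
  have h : IsSES (D.f s.Carrier) (q ∘ₗ s.botEquiv.toLinearMap) := by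
    refine ⟨?_, fun y => ?_, hs.surj.comp s.botEquiv.surjective⟩
    · rw [injective_iff_map_eq_zero]
      intro z hz
      have := botEquiv_f s z
      rw [hz, map_zero] at this
      rw [← hc z, hs.inj (this.symm.trans (map_zero _).symm), map_zero]
    · refine (hs.exact _).trans ⟨?_, ?_⟩
      · rintro ⟨z, hz⟩
        refine ⟨BalTensor.lTensor B M s.topEquiv.symm.toLinearMap z, s.botEquiv.injective ?_⟩
        rw [botEquiv_f, hc', hz]
        rfl
      · rintro ⟨z, rfl⟩
        exact ⟨_, (botEquiv_f s z).symm⟩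
  exact ⟨hV.congr_left h.quotEquiv.symm hC, hU.congr_left s.topEquiv.symm hX, h.inj⟩

theorem classN₁_of_isSES (hU : IsCotorsionPair 𝒰 𝒳) (hV : IsCotorsionPair 𝒱 𝒴) {s : D.Quad X Y}
    {j : K →ₗ[B] Y} (hs : IsSES j s.k) (hK : 𝒴 (ModuleCat.of B K)) (hX : 𝒳 (ModuleCat.of A X)) :
    D.classN₁ 𝒳 𝒴 (ModuleCat.of _ s.Carrier) := by
  have hc : ∀ z w, HomLeft.postcomp B N s.topEquiv.toLinearMap z =
      HomLeft.postcomp B N s.topEquiv.toLinearMap w → z = w := fun z w h =>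
    HomLeft.ext fun n => s.topEquiv.injective (DFunLike.congr_fun h n)
  have h : IsSES (s.botEquiv.symm.toLinearMap ∘ₗ j) (D.gTilde s.Carrier) := by
    refine ⟨s.botEquiv.symm.injective.comp hs.inj, fun y => ⟨fun hy => ?_, ?_⟩, fun h => ?_⟩
    · obtain ⟨x, hx⟩ := (hs.exact (s.botEquiv y)).1 (by rw [← gTilde_eq, hy, map_zero])
      exact ⟨x, s.botEquiv.symm_apply_eq.2 hx⟩
    · rintro ⟨x, rfl⟩
      refine hc _ _ ?_
      rw [gTilde_eq, map_zero]
      exact (congrArg s.k (s.botEquiv.apply_symm_apply _)).trans (hs.exact.apply_apply_eq_zero x)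
    · obtain ⟨y, hy⟩ := hs.surj (HomLeft.postcomp B N s.topEquiv.toLinearMap h)
      refine ⟨s.botEquiv.symm y, hc _ _ ?_⟩
      rw [gTilde_eq, LinearEquiv.apply_symm_apply, hy]
  exact ⟨hV.congr_right h.kerEquiv hK, hU.congr_right s.topEquiv.symm hX, h.surj⟩

theorem classN₁.extZero_tensorQuad (hU : IsCotorsionPair 𝒰 𝒳)
    {W : ModuleCat.{u} (MoritaRing D)} (hW : D.classN₁ 𝒳 𝒴 W)
    (hX : 𝒰 (ModuleCat.of A X)) : ExtZero (MoritaRing D) (D.tensorQuad X).Carrier W :=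
  (Quad.extZero_tensorQuad (hU.extZero hX hW.2.1)).congr_right (D.equivQuadOf W)

theorem classN₁.extZero_botQuad (hV : IsCotorsionPair 𝒱 𝒴)
    {W : ModuleCat.{u} (MoritaRing D)} (hW : D.classN₁ 𝒳 𝒴 W)
    (hY : 𝒱 (ModuleCat.of B Y)) : ExtZero (MoritaRing D) (D.botQuad Y).Carrier W :=
  (Quad.extZero_botQuad_left (s := D.quadOf W) (LinearMap.isSES_ker hW.2.2)
    (hV.extZero hY hW.1)).congr_right (D.equivQuadOf W)

theorem classM₁.extZero_homQuad (hU : IsCotorsionPair 𝒰 𝒳)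
    {W : ModuleCat.{u} (MoritaRing D)} (hW : D.classM₁ 𝒰 𝒱 W)
    (hX : 𝒳 (ModuleCat.of A X)) : ExtZero (MoritaRing D) W (D.homQuad X).Carrier :=
  (Quad.extZero_homQuad (hU.extZero hW.2.1 hX)).congr_left (D.equivQuadOf W)

theorem classM₁.extZero_botQuad (hV : IsCotorsionPair 𝒱 𝒴)
    {W : ModuleCat.{u} (MoritaRing D)} (hW : D.classM₁ 𝒰 𝒱 W)
    (hY : 𝒴 (ModuleCat.of B Y)) : ExtZero (MoritaRing D) W (D.botQuad Y).Carrier :=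
  (Quad.extZero_botQuad_right (s := D.quadOf W) (LinearMap.isSES_range hW.2.2)
    (hV.extZero hW.1 hY)).congr_left (D.equivQuadOf W)

/-- Every module has an epimorphism with coinduced kernel in the class `H 𝒳` from a module with
first component in `𝒰`. -/
theorem Quad.exists_precover_top (hN : ∀ X, 𝒳 X → ExtZero A N X) (cU : IsCompletePair 𝒰 𝒳)
    (s : D.Quad X Y) : ∃ (X₁ U Y₁ : Type u) (_ : AddCommGroup X₁) (_ : Module A X₁)
      (_ : AddCommGroup U) (_ : Module A U) (_ : AddCommGroup Y₁) (_ : Module B Y₁)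
      (t : D.Quad U Y₁) (F : (D.homQuad X₁).Carrier →ₗ[MoritaRing D] t.Carrier)
      (G : t.Carrier →ₗ[MoritaRing D] s.Carrier),
      IsSES F G ∧ 𝒰 (ModuleCat.of A U) ∧ 𝒳 (ModuleCat.of A X₁) := by
  obtain ⟨X₁, U, _, _, _, _, i, p, hs, hU', hX₁⟩ := cU.exists_precover X
  have hs' := HomLeft.isSES_postcomp (B := B) (hN _ hX₁) hs
  -- The second component is the pullback of `Hom_A(N, U) → Hom_A(N, X) ← Y`, so the kernel of its
  -- projection to `Y` is `Hom_A(N, X₁)` and the whole kernel is coinduced.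
  let t : D.Quad U (LinearMap.pullback (HomLeft.postcomp B N p) s.k) :=
    ⟨LinearMap.pullbackLift (D.kappa U) (s.f ∘ₗ BalTensor.lTensor B M p)
      (LinearMap.ext fun z => (D.kappa_natural_apply p z).trans (s.k_f _).symm),
      LinearMap.pullbackFst _ _, fun _ => rfl⟩
  have hp : ∀ z, BalTensor.lTensor B M p (BalTensor.lTensor B M i z) = 0 := fun z => by
    rw [← LinearMap.comp_apply, ← BalTensor.lTensor_comp, hs.exact.linearMap_comp_eq_zero]
    exact BalTensor.lmap_zero z
  refine ⟨X₁, U, _, _, _, _, _, _, _, t,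
    hom i (LinearMap.pullbackLift (HomLeft.postcomp B N i) 0 ?_) ?_ rfl,
    hom p (LinearMap.pullbackSnd _ _) rfl ?_, ?_, hU', hX₁⟩
  · rw [hs'.exact.linearMap_comp_eq_zero, LinearMap.comp_zero]
  · refine LinearMap.ext fun z => Subtype.ext (Prod.ext (D.kappa_natural_apply i z) ?_)
    exact ((congrArg s.f (hp z)).trans (map_zero _)).symm
  · exact LinearMap.ext fun z => z.2.symm
  · exact isSES_iff.2 ⟨hs, hs'.pullback_snd s.k⟩

theorem isSES_topHom_botHom {W₁ W₂ W₃ : Type u} [AddCommGroup W₁] [Module (MoritaRing D) W₁]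
    [AddCommGroup W₂] [Module (MoritaRing D) W₂] [AddCommGroup W₃] [Module (MoritaRing D) W₃]
    {F : W₁ →ₗ[MoritaRing D] W₂} {G : W₂ →ₗ[MoritaRing D] W₃} (h : IsSES F G) :
    ∃ (F' : (D.quadOf W₁).Carrier →ₗ[MoritaRing D] (D.quadOf W₂).Carrier)
      (G' : (D.quadOf W₂).Carrier →ₗ[MoritaRing D] (D.quadOf W₃).Carrier),
      IsSES (topHom F') (topHom G') ∧ IsSES (botHom F') (botHom G') :=
  ⟨_, _, isSES_iff.1 (h.conj (D.equivQuadOf W₁).symm (D.equivQuadOf W₂).symm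
    (D.equivQuadOf W₃).symm)⟩

/-- The hypotheses keep the sequence of first components exact under `M ⊗ -`, respectively `Hom_A(N,
-)`. The snake lemma then gives exact sequences of the cokernels of `f`, respectively of the kernels
of `g̃`, to which heredity of the pair over `B` applies. -/
theorem isHereditaryPair_classM₁_classN₁ (hT : ∀ U, 𝒰 U → TorOneVanishes A M U)
    (hN : ∀ X, 𝒳 X → ExtZero A N X) (cU : IsHereditaryPair 𝒰 𝒳) (cV : IsHereditaryPair 𝒱 𝒴) :
    IsHereditaryPair (D.classM₁ 𝒰 𝒱) (D.classN₁ 𝒳 𝒴) := by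
  constructor
  · intro S hS h₂ h₃
    obtain ⟨F, G, ht, hb⟩ := isSES_topHom_botHom ((ModuleCat.shortExact_iff_isSES _).1 hS)
    have hM := BalTensor.isSES_lTensor (B := B) (hT _ h₃.2.1) ht
    have hq := hM.cokernels hb (botHom_f F).symm (botHom_f G).symm h₃.2.2
    refine ⟨cV.1 _ hq.shortExact h₂.1 h₃.1, cU.1 _ ht.shortExact h₂.2.1 h₃.2.1, ?_⟩
    have : Function.Injective (botHom F ∘ₗ D.f S.X₁) := by
      rw [show botHom F ∘ₗ D.f S.X₁ = _ from botHom_f F]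
      exact h₂.2.2.comp hM.inj
    rw [LinearMap.coe_comp] at this
    exact this.of_comp
  · intro S hS h₁ h₂
    obtain ⟨F, G, ht, hb⟩ := isSES_topHom_botHom ((ModuleCat.shortExact_iff_isSES _).1 hS)
    have hM := HomLeft.isSES_postcomp (B := B) (hN _ h₁.2.1) ht
    have hq := hb.kernels hM (k_botHom F) (k_botHom G) h₁.2.2
    refine ⟨cV.2 _ hq.shortExact h₁.1 h₂.1, cU.2 _ ht.shortExact h₁.2.1 h₂.2.1, ?_⟩
    have : Function.Surjective (D.gTilde S.X₃ ∘ₗ botHom G) := by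
      rw [show D.gTilde S.X₃ ∘ₗ botHom G = _ from k_botHom G]
      exact hM.surj.comp h₂.2.2
    exact Function.Surjective.of_comp this

variable (hU : IsCotorsionPair 𝒰 𝒳) (hV : IsCotorsionPair 𝒱 𝒴)
include hU hV

variable (D)

theorem classM₁_tensorQuad (hX : 𝒰 (ModuleCat.of A X)) :
    D.classM₁ 𝒰 𝒱 (ModuleCat.of _ (D.tensorQuad X).Carrier) :=
  classM₁_of_isSES hU hV (s := D.tensorQuad X) isSES_id_zero hV.of_subsingleton_left hX

theorem classM₁_botQuad (hY : 𝒱 (ModuleCat.of B Y)) :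
    D.classM₁ 𝒰 𝒱 (ModuleCat.of _ (D.botQuad Y).Carrier) :=
  classM₁_of_isSES hU hV (D.isSES_botQuad_f) hY hU.of_subsingleton_left

theorem classN₁_homQuad (hX : 𝒳 (ModuleCat.of A X)) :
    D.classN₁ 𝒳 𝒴 (ModuleCat.of _ (D.homQuad X).Carrier) :=
  classN₁_of_isSES hU hV (s := D.homQuad X) isSES_zero_id hV.of_subsingleton_right hX

theorem classN₁_botQuad (hY : 𝒴 (ModuleCat.of B Y)) :
    D.classN₁ 𝒳 𝒴 (ModuleCat.of _ (D.botQuad Y).Carrier) :=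
  classN₁_of_isSES hU hV (D.isSES_botQuad_k) hY hU.of_subsingleton_right

variable {D}

/-- The induced modules on `𝒰` detect that the first component is in `𝒳`, and the modules `(0, V)`
detect the conditions on `g̃`. Surjectivity comes first, from `V = B`, which is projective and so in
`𝒱`. -/
theorem classN₁_of_extZero (hT : ∀ U, 𝒰 U → TorOneVanishes A M U)
    {W : ModuleCat.{u} (MoritaRing D)}
    (h₁ : ∀ U : ModuleCat.{u} A, 𝒰 U → ExtZero (MoritaRing D) (D.tensorQuad U).Carrier W)
    (h₂ : ∀ V : ModuleCat.{u} B, 𝒱 V → ExtZero (MoritaRing D) (D.botQuad V).Carrier W) :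
    D.classN₁ 𝒳 𝒴 W := by
  have hk : Function.Surjective (D.quadOf W).k :=
    k_surjective ((h₂ _ (hV.of_projective (X := B))).congr_right (D.equivQuadOf W).symm)
  exact ⟨hV.mem_right.2 fun V hV' => extZero_of_extZero_botQuad_left (LinearMap.isSES_ker hk)
      ((h₂ V hV').congr_right (D.equivQuadOf W).symm),
    hU.mem_right.2 fun U hU' => extZero_of_extZero_tensorQuad (hT U hU')
      ((h₁ U hU').congr_right (D.equivQuadOf W).symm), hk⟩

theorem classM₁_of_extZero (hN : ∀ X, 𝒳 X → ExtZero A N X)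
    {W : ModuleCat.{u} (MoritaRing D)}
    (h₁ : ∀ X : ModuleCat.{u} A, 𝒳 X → ExtZero (MoritaRing D) W (D.homQuad X).Carrier)
    (h₂ : ∀ Y : ModuleCat.{u} B, 𝒴 Y → ExtZero (MoritaRing D) W (D.botQuad Y).Carrier) :
    D.classM₁ 𝒰 𝒱 W := by
  -- An injective module is in `𝒴`, so `(0, I)` is an admissible test module for injectivity of `f`.
  obtain ⟨I, _, _, i, hi, hI⟩ := exists_injective_embedding B (BalTensor A M (D.Top W))
  have hf : Function.Injective (D.quadOf W).f :=
    f_injective (V := I) (h := i) hi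
      ((h₂ (ModuleCat.of B I) hV.of_injective).congr_left (D.equivQuadOf W).symm)
  refine ⟨hV.mem_left.2 fun Y hY => ?_, hU.mem_left.2 fun X hX => ?_, hf⟩
  · have := (h₂ Y hY).congr_left (D.equivQuadOf W).symm
    exact extZero_of_extZero_botQuad_right (s := D.quadOf W) (LinearMap.isSES_range hf) this
  · have := (h₁ X hX).congr_left (D.equivQuadOf W).symm
    exact extZero_of_extZero_homQuad (hN X hX) this

/-- All the test modules lie in the left perpendicular class, so whatever is right orthogonal to
that class passes the tests. -/
theorem isCotorsionPair_classN₁ (hT : ∀ U, 𝒰 U → TorOneVanishes A M U) :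
    IsCotorsionPair (extLeftPerp (D.classN₁ 𝒳 𝒴)) (D.classN₁ 𝒳 𝒴) := by
  refine ⟨funext fun W => propext ⟨fun h => ?_, fun h C hC => hC W h⟩, rfl⟩
  exact classN₁_of_extZero hU hV hT
    (fun U hU' => h _ fun W' hW' => classN₁.extZero_tensorQuad hU hW' hU')
    fun V hV' => h _ fun W' hW' => classN₁.extZero_botQuad hV hW' hV'

theorem isCotorsionPair_classM₁ (hN : ∀ X, 𝒳 X → ExtZero A N X) :
    IsCotorsionPair (D.classM₁ 𝒰 𝒱) (extRightPerp (D.classM₁ 𝒰 𝒱)) := by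
  refine ⟨rfl, funext fun W => propext ⟨fun h => ?_, fun h C hC => hC W h⟩⟩
  exact classM₁_of_extZero hU hV hN
    (fun X hX => h _ fun W' hW' => classM₁.extZero_homQuad hU hW' hX)
    fun Y hY => h _ fun W' hW' => classM₁.extZero_botQuad hV hW' hY

/-- For `f` mono, `W` is an extension of `(0, Coker f)` by the induced module on its first
component, and both are left orthogonal to `N`. -/
theorem classM₁.extZero {W W' : ModuleCat.{u} (MoritaRing D)} (hW : D.classM₁ 𝒰 𝒱 W)
    (hW' : D.classN₁ 𝒳 𝒴 W') : ExtZero (MoritaRing D) W W' := by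
  let s := D.quadOf W
  have hs : IsSES s.f (LinearMap.range s.f).mkQ := LinearMap.isSES_range hW.2.2
  have h : IsSES (tensorHom s LinearMap.id)
      (toBot (s := s) (LinearMap.range s.f).mkQ hs.exact.linearMap_comp_eq_zero) := by
    refine isSES_iff.2 ⟨⟨fun _ _ e => e, fun x => ⟨fun _ => ⟨x, rfl⟩, fun _ => rfl⟩,
      fun _ => ⟨0, rfl⟩⟩, ?_⟩
    rw [botHom_tensorHom, BalTensor.lTensor_id]
    exact hs
  exact (ExtZero.middle_left h (classN₁.extZero_tensorQuad hU hW' hW.2.1)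
    (classN₁.extZero_botQuad hV hW' hW.1)).congr_left (D.equivQuadOf W)

/-- The test modules themselves lie in the two classes, so orthogonality to a whole class implies
passing the tests. -/
theorem isCotorsionPair_classM₁_classN₁ (hT : ∀ U, 𝒰 U → TorOneVanishes A M U)
    (hN : ∀ X, 𝒳 X → ExtZero A N X) :
    IsCotorsionPair (D.classM₁ 𝒰 𝒱) (D.classN₁ 𝒳 𝒴) := by
  refine ⟨funext fun W => propext ⟨fun h => ?_, fun h C hC => hC.extZero hU hV h⟩,
    funext fun W => propext ⟨fun h => ?_, fun h C hC => h.extZero hU hV hC⟩⟩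
  · exact classN₁_of_extZero hU hV hT (fun U hU' => h _ (D.classM₁_tensorQuad hU hV hU'))
      fun V hV' => h _ (D.classM₁_botQuad hU hV hV')
  · exact classM₁_of_extZero hU hV hN (fun X hX => h _ (D.classN₁_homQuad hU hV hX))
      fun Y hY => h _ (D.classN₁_botQuad hU hV hY)

/-- A special precover is reached by three epimorphisms onto `W`, which in turn bring the first
component into `𝒰`, make `f` mono, and bring `Coker f` into `𝒱`. Later steps leave the first
component alone. -/
theorem isCompletePair_classM₁_classN₁ (hT : ∀ U, 𝒰 U → TorOneVanishes A M U)
    (hN : ∀ X, 𝒳 X → ExtZero A N X) (cU : IsCompletePair 𝒰 𝒳) (cV : IsCompletePair 𝒱 𝒴) :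
    IsCompletePair (D.classM₁ 𝒰 𝒱) (D.classN₁ 𝒳 𝒴) := by
  have hMN := isCotorsionPair_classM₁_classN₁ (D := D) hU hV hT hN
  refine hMN.isCompletePair_of_precovers fun W _ _ => ?_
  obtain ⟨X₁, U, Y₁, _, _, _, _, _, _, t, F, G, hFG, hUU, hX₁⟩ :=
    exists_precover_top hN cU (D.quadOf W)
  obtain ⟨I, _, _, h, hh, hI⟩ := exists_injective_embedding B (BalTensor A M U)
  -- make `f` injective
  let t₂ := t.pullBot (LinearMap.snd B I Y₁) (h.prod t.f) (LinearMap.snd_prod _ _)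
  have hs₂ : IsSES (LinearMap.inl B I Y₁) (LinearMap.snd B I Y₁) :=
    ⟨LinearMap.inl_injective, Function.Exact.inl_snd, LinearMap.snd_surjective⟩
  have ht₂ := isSES_pullBot (s := t) hs₂ (f := h.prod t.f) (LinearMap.snd_prod _ _)
  have hf₂ : Function.Injective t₂.f := fun a b e => hh (congrArg Prod.fst e)
  -- move the cokernel of `f` into `𝒱`
  have hr := LinearMap.isSES_range hf₂
  obtain ⟨Y₃, V, _, _, _, _, j, p, hjp, hVV, hY₃⟩ :=
    cV.exists_precover (_ ⧸ LinearMap.range t₂.f)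
  -- Pulling back along `V → Coker f` keeps `f` mono and makes its cokernel exactly `V`, while the
  -- kernel added is `(0, Y₃)`.
  have hf₃ := hr.pullback_fst p
  have ht₃ := isSES_pullBot (s := t₂) (hjp.pullback_snd (LinearMap.range t₂.f).mkQ) (f :=
    LinearMap.pullbackLift 0 t₂.f (by rw [hr.exact.linearMap_comp_eq_zero, LinearMap.comp_zero])) rfl
  -- The kernel of the composite is an iterated extension of the three kernels, so it stays in `N`.
  obtain ⟨K₁, _, _, a, b, c, hab, hc⟩ := ht₃.exists_comp ht₂
  obtain ⟨K₂, _, _, a', b', c', hab', hc'⟩ := hc.exists_comp hFG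
  refine ⟨K₂, _, _, _, _, _, c', _, hc'.comp_equiv (D.equivQuadOf W),
    classM₁_of_isSES hU hV hf₃ hVV hUU, ?_⟩
  refine hMN.middle_right hab' (hMN.middle_right hab ?_ ?_) ?_
  · exact D.classN₁_botQuad hU hV hY₃
  · exact D.classN₁_botQuad hU hV hV.of_injective
  · exact D.classN₁_homQuad hU hV hX₁

end MoritaContext

end MoritaCotorsion

/-! ### Transport of cotorsion pairs along a ring isomorphism. -/

section RingEquiv

variable {R R' : Type u} [Ring R] [Ring R'] (σ : R' ≃+* R)

theorem ExtZero.restrictScalars_iff (C X : ModuleCat.{u} R) :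
    ExtZero R' ((ModuleCat.restrictScalars σ.toRingHom).obj C)
      ((ModuleCat.restrictScalars σ.toRingHom).obj X) ↔ ExtZero R C X :=
  have : (ModuleCat.restrictScalars.{u} σ.toRingHom).IsEquivalence :=
    (ModuleCat.restrictScalarsEquivalenceOfRingEquiv σ).isEquivalence_functor
  (Equiv.ofBijective _ (Functor.mapExt_bijective_of_preservesProjectiveObjects
    (ModuleCat.restrictScalars σ.toRingHom) C X 1)).subsingleton_congr.symm

variable {σ} {𝒞 𝒟 : ObjectProperty (ModuleCat.{u} R')}

theorem IsCotorsionPair.of_iso_left (h : IsCotorsionPair 𝒞 𝒟) {X Y : ModuleCat.{u} R'} (i : X ≅ Y)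
    (hX : 𝒞 X) : 𝒞 Y :=
  h.congr_left (X := X) (Y := Y) i.toLinearEquiv hX

theorem IsCotorsionPair.of_iso_right (h : IsCotorsionPair 𝒞 𝒟) {X Y : ModuleCat.{u} R'} (i : X ≅ Y)
    (hX : 𝒟 X) : 𝒟 Y :=
  h.congr_right (X := X) (Y := Y) i.toLinearEquiv hX

/-- Restriction along an isomorphism is an equivalence: it preserves and reflects vanishing of
`Ext¹`, and up to isomorphism it reaches every `R'`-module. -/
theorem IsCotorsionPair.restrictScalars (h : IsCotorsionPair 𝒞 𝒟) :
    IsCotorsionPair (𝒞.inverseImage (ModuleCat.restrictScalars σ.toRingHom))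
      (𝒟.inverseImage (ModuleCat.restrictScalars σ.toRingHom)) := by
  let e := ModuleCat.restrictScalarsEquivalenceOfRingEquiv.{u} σ
  refine ⟨funext fun X => propext ⟨fun hX => h.mem_right.2 fun Y hY => ?_, fun hX Y hY =>
      (ExtZero.restrictScalars_iff σ _ _).1 (h.extZero hY hX)⟩,
    funext fun X => propext ⟨fun hX => h.mem_left.2 fun Y hY => ?_, fun hX Y hY =>
      (ExtZero.restrictScalars_iff σ _ _).1 (h.extZero hX hY)⟩⟩
  · exact ((ExtZero.restrictScalars_iff σ _ _).2
      (hX (e.inverse.obj Y) (h.of_iso_left (e.counitIso.app Y).symm hY))).congr_left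
        (e.counitIso.app Y).toLinearEquiv
  · exact ((ExtZero.restrictScalars_iff σ _ _).2
      (hX (e.inverse.obj Y) (h.of_iso_right (e.counitIso.app Y).symm hY))).congr_right
        (e.counitIso.app Y).toLinearEquiv

theorem IsCompletePair.restrictScalars (h : IsCotorsionPair 𝒞 𝒟) (hc : IsCompletePair 𝒞 𝒟) :
    IsCompletePair (𝒞.inverseImage (ModuleCat.restrictScalars σ.toRingHom))
      (𝒟.inverseImage (ModuleCat.restrictScalars σ.toRingHom)) := by
  let e := ModuleCat.restrictScalarsEquivalenceOfRingEquiv.{u} σ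
  have : e.inverse.Additive := inferInstanceAs (ModuleCat.restrictScalars _).Additive
  refine h.restrictScalars.isCompletePair_of_precovers fun Z _ _ => ?_
  obtain ⟨⟨K, C, i, p, w, hs, hC, hK⟩, -⟩ := hc (e.functor.obj (ModuleCat.of R Z))
  refine ⟨e.inverse.obj K, e.inverse.obj C, _, _, _, _, _, _,
    ((ModuleCat.shortExact_iff_isSES _).1 (hs.map_of_exact e.inverse)).comp_equiv
      (e.unitIso.app (ModuleCat.of R Z)).symm.toLinearEquiv,
    h.of_iso_left (e.counitIso.app C).symm hC,
    h.of_iso_right (e.counitIso.app K).symm hK⟩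

theorem IsHereditaryPair.restrictScalars (h : IsHereditaryPair 𝒞 𝒟) :
    IsHereditaryPair (𝒞.inverseImage (ModuleCat.restrictScalars σ.toRingHom))
      (𝒟.inverseImage (ModuleCat.restrictScalars σ.toRingHom)) :=
  ⟨fun S hS => h.1 (S.map (ModuleCat.restrictScalars σ.toRingHom)) (hS.map_of_exact _),
    fun S hS => h.2 (S.map (ModuleCat.restrictScalars σ.toRingHom)) (hS.map_of_exact _)⟩

/-- Restricting a pair `(^⊥𝒟, 𝒟)` gives the preimage of `^⊥𝒟`, not literally the perpendicular of
the preimage of `𝒟`; this replaces the one by the other. -/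
theorem IsCotorsionPair.left_eq {𝒞 𝒟 : ObjectProperty (ModuleCat.{u} R)}
    (h : IsCotorsionPair 𝒞 𝒟) : IsCotorsionPair (extLeftPerp 𝒟) 𝒟 := h.2 ▸ h

theorem IsCotorsionPair.right_eq {𝒞 𝒟 : ObjectProperty (ModuleCat.{u} R)}
    (h : IsCotorsionPair 𝒞 𝒟) : IsCotorsionPair 𝒞 (extRightPerp 𝒞) := h.1 ▸ h

end RingEquiv

/-! ### Exchanging the two corners of the Morita ring. -/

section Swap

variable {A B M N : Type u} [Ring A] [Ring B]
  [AddCommGroup M] [Module B M] [Module Aᵐᵒᵖ M] [SMulCommClass B Aᵐᵒᵖ M]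
  [AddCommGroup N] [Module A N] [Module Bᵐᵒᵖ N] [SMulCommClass A Bᵐᵒᵖ N]

namespace MoritaContext

variable (D : MoritaContext A B M N)

/-- The Morita context with the two corners exchanged. -/
def swap : MoritaContext B A N M where
  φ := D.ψ
  φ_right := D.ψ_right
  ψ := D.φ
  ψ_right := D.φ_right
  smul_ψ n' n m := D.smul_φ n' n m
  smul_φ m' m n := D.smul_ψ m' m n

/-- Exchanging the two corners does not change the Morita ring. -/
def swapEquiv : MoritaRing D.swap ≃+* MoritaRing D where
  toFun x := ⟨x.b, x.m, x.n, x.a⟩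
  invFun x := ⟨x.b, x.m, x.n, x.a⟩
  left_inv _ := rfl
  right_inv _ := rfl
  map_mul' x y := by
    ext
    · exact add_comm _ _
    · exact add_comm _ _
    · exact add_comm _ _
    · exact add_comm _ _
  map_add' _ _ := rfl

variable (𝒰 𝒳 : ObjectProperty (ModuleCat.{u} A)) (𝒱 𝒴 : ObjectProperty (ModuleCat.{u} B))

/-- The exchange isomorphism interchanges the idempotents and the off-diagonal entries, so
components and structure maps agree definitionally. -/
theorem classN₁_swap : (D.swap.classN₁ 𝒴 𝒳).inverseImage
    (ModuleCat.restrictScalars D.swapEquiv.toRingHom) = D.classN₂ 𝒳 𝒴 :=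
  funext fun _ => rfl

theorem classM₁_swap : (D.swap.classM₁ 𝒱 𝒰).inverseImage
    (ModuleCat.restrictScalars D.swapEquiv.toRingHom) = D.classM₂ 𝒰 𝒱 :=
  funext fun _ => rfl

end MoritaContext

end Swap

theorem corollary4p8 {A B M N : Type u} [Ring A] [Ring B]
    [AddCommGroup M] [Module B M] [Module Aᵐᵒᵖ M] [SMulCommClass B Aᵐᵒᵖ M]
    [AddCommGroup N] [Module A N] [Module Bᵐᵒᵖ N] [SMulCommClass A Bᵐᵒᵖ N]
    (D : MoritaContext A B M N)
    (𝒰 𝒳 : ObjectProperty (ModuleCat.{u} A)) (𝒱 𝒴 : ObjectProperty (ModuleCat.{u} B))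
    (hUX : IsCotorsionPair 𝒰 𝒳) (hVY : IsCotorsionPair 𝒱 𝒴) :
    -- the case `M ⊗_A N = 0`
    (Subsingleton (BalTensor A M N) →
      ((∀ U, 𝒰 U → TorOneVanishes A M U) →
        IsCotorsionPair (extLeftPerp (D.classN₁ 𝒳 𝒴)) (D.classN₁ 𝒳 𝒴)) ∧
      ((∀ X, 𝒳 X → Subsingleton (Ext (ModuleCat.of A N) X 1)) →
        IsCotorsionPair (D.classM₁ 𝒰 𝒱) (extRightPerp (D.classM₁ 𝒰 𝒱))) ∧
      ((∀ U, 𝒰 U → TorOneVanishes A M U) →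
        (∀ X, 𝒳 X → Subsingleton (Ext (ModuleCat.of A N) X 1)) →
        IsCotorsionPair (D.classM₁ 𝒰 𝒱) (D.classN₁ 𝒳 𝒴) ∧
        (IsCompletePair 𝒰 𝒳 ∧ IsHereditaryPair 𝒰 𝒳 →
          IsCompletePair 𝒱 𝒴 ∧ IsHereditaryPair 𝒱 𝒴 →
          IsCompletePair (D.classM₁ 𝒰 𝒱) (D.classN₁ 𝒳 𝒴) ∧
          IsHereditaryPair (D.classM₁ 𝒰 𝒱) (D.classN₁ 𝒳 𝒴)))) ∧
    -- the case `N ⊗_B M = 0`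
    (Subsingleton (BalTensor B N M) →
      ((∀ V, 𝒱 V → TorOneVanishes B N V) →
        IsCotorsionPair (extLeftPerp (D.classN₂ 𝒳 𝒴)) (D.classN₂ 𝒳 𝒴)) ∧
      ((∀ Y, 𝒴 Y → Subsingleton (Ext (ModuleCat.of B M) Y 1)) →
        IsCotorsionPair (D.classM₂ 𝒰 𝒱) (extRightPerp (D.classM₂ 𝒰 𝒱))) ∧
      ((∀ V, 𝒱 V → TorOneVanishes B N V) →
        (∀ Y, 𝒴 Y → Subsingleton (Ext (ModuleCat.of B M) Y 1)) →
        IsCotorsionPair (D.classM₂ 𝒰 𝒱) (D.classN₂ 𝒳 𝒴) ∧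
        (IsCompletePair 𝒰 𝒳 ∧ IsHereditaryPair 𝒰 𝒳 →
          IsCompletePair 𝒱 𝒴 ∧ IsHereditaryPair 𝒱 𝒴 →
          IsCompletePair (D.classM₂ 𝒰 𝒱) (D.classN₂ 𝒳 𝒴) ∧
          IsHereditaryPair (D.classM₂ 𝒰 𝒱) (D.classN₂ 𝒳 𝒴)))) := by 
  constructor
  · intro hMN
    refine ⟨MoritaContext.isCotorsionPair_classN₁ hUX hVY,
      MoritaContext.isCotorsionPair_classM₁ hUX hVY, fun hT hN =>
      ⟨MoritaContext.isCotorsionPair_classM₁_classN₁ hUX hVY hT hN, fun hU hV =>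
      ⟨MoritaContext.isCompletePair_classM₁_classN₁ hUX hVY hT hN hU.1 hV.1,
        MoritaContext.isHereditaryPair_classM₁_classN₁ hT hN hU.2 hV.2⟩⟩⟩
  · intro hNM
    -- For the exchanged context this is the case already proved, with the two given cotorsion pairs
    -- in opposite roles.
    rw [← D.classN₁_swap, ← D.classM₁_swap]
    refine ⟨fun hT => (MoritaContext.isCotorsionPair_classN₁ hVY hUX hT).restrictScalars.left_eq,
      fun hN => (MoritaContext.isCotorsionPair_classM₁ hVY hUX hN).restrictScalars.right_eq,
      fun hT hN => ?_⟩
    have h := MoritaContext.isCotorsionPair_classM₁_classN₁ (D := D.swap) hVY hUX hT hN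
    exact ⟨h.restrictScalars, fun hU hV =>
      ⟨.restrictScalars h
        (MoritaContext.isCompletePair_classM₁_classN₁ hVY hUX hT hN hV.1 hU.1),
      .restrictScalars (MoritaContext.isHereditaryPair_classM₁_classN₁ hT hN hV.2 hU.2)⟩⟩
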